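/- Let $r\ge 1$ and $n\ge 0$ be integers, let $\zeta_r=e^{2\pi i/r}$, and let $G=G(r,n)$ be the group (under matrix multiplication) of all complex $n\times n$ matrices with exactly one non-zero entry in every row and every column, all of whose non-zero entries are $r$-th roots of unity. For $g\in G$ let $\bar g$ be the complex conjugate matrix and let $|g|$ be the permutation matrix of the absolute values of the entries of $g$. Regard $g$ as a colored permutation: $g e_i=\zeta_r^{z_i(g)}e_{|g|(i)}$ for $1\le i\le n$, where $e_1,\dots,e_n$ is the standard basis of $\mathbb C^n$, $z_i(g)\in\mathbb Z/r\mathbb Z$, and $|g|$ also denotes the corresponding permutation of $\{1,\dots,n\}$. Let $$I=\{v\in G: v\bar v=1\}$$ be the set of absolute involutions of $G$. For $g\in G$ and $v\in I$ put $\langle g,v\rangle=\sum_{i=1}^n z_i(g)z_i(v)\in\mathbb Z/r\mathbb Z$, and let $\mathrm{inv}_v(g)$ be the number of pairs $i<j$ such that $|v|(i)=j$ and $|g|(i)>|g|(j)$. Then $I$ is exactly the set of symmetric matrices in $G$. Moreover, on the complex vector space $M=\bigoplus_{v\in I}\mathbb C\,C_v$ with basis $(C_v)_{v\in I}$, the rule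 $$\varrho(g)\,C_v=\zeta_r^{\langle g,v\rangle}\,(-1)^{\mathrm{inv}_v(g)}\,C_{|g|\,v\,|g|^{-1}}\qquad(g\in G,\ v\in I)$$ defines a representation $\varrho:G\to GL(M)$, and $(M,\varrho)$ is a $G$-model: it is the direct sum of all irreducible complex representations of $G$, each occurring with multiplicity exactly one. (The same formula is used for $r$ odd and for $r$ even.) -/

import Mathlib

open scoped Matrix

noncomputable section

namespace WreathModel

/-- The primitive `r`-th root of unity `exp(2πi/r)`. -/
def zeta (r : ℕ) : ℂ := Complex.exp (2 * Real.pi * Complex.I / r)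

/-- `A` is an `n × n` complex matrix whose non-zero entries are `r`-th roots of unity, with exactly
one non-zero entry in every row and every column. -/
structure IsMonomial (r : ℕ) {n : ℕ} (A : Matrix (Fin n) (Fin n) ℂ) : Prop where
  root : ∀ i j, A i j ≠ 0 → A i j ^ r = 1
  row : ∀ i, ∃! j, A i j ≠ 0
  col : ∀ j, ∃! i, A i j ≠ 0

/-- The transpose of the matrix of entrywise inverses. -/
def invT {n : ℕ} (A : Matrix (Fin n) (Fin n) ℂ) : Matrix (Fin n) (Fin n) ℂ :=
  Matrix.of fun i j => (A j i)⁻¹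

theorem IsMonomial.mul_invT {r n : ℕ} {A : Matrix (Fin n) (Fin n) ℂ} (h : IsMonomial r A) :
    A * invT A = 1 := by
  ext i k
  rw [Matrix.mul_apply]
  obtain ⟨j, hj, hu⟩ := h.row i
  rw [Finset.sum_eq_single j]
  · by_cases hik : i = k
    · subst hik
      simp [invT, hj]
    · have : A k j = 0 := by
        by_contra hk
        exact hik ((h.col j).unique hj hk)
      simp [invT, this, hik]
  · intro b _ hb
    have : A i b = 0 := by
      by_contra hk
      exact hb (hu b hk)
    simp [this]
  · simp

theorem IsMonomial.isMonomial_invT {r n : ℕ} {A : Matrix (Fin n) (Fin n) ℂ}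
    (h : IsMonomial r A) : IsMonomial r (invT A) where
  root i j hij := by
    have : A j i ≠ 0 := by simpa [invT] using hij
    simp [invT, h.root j i this]
  row i := by simpa [invT] using h.col i
  col i := by simpa [invT] using h.row i

theorem IsMonomial.one (r n : ℕ) : IsMonomial r (1 : Matrix (Fin n) (Fin n) ℂ) where
  root i j hij := by
    have : i = j := by
      by_contra h
      exact hij (Matrix.one_apply_ne h)
    rw [this, Matrix.one_apply_eq, one_pow]
  row i := ⟨i, by simp, fun j hj => by
    by_contra h
    exact hj (Matrix.one_apply_ne (Ne.symm h))⟩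
  col i := ⟨i, by simp, fun j hj => by
    by_contra h
    exact hj (Matrix.one_apply_ne h)⟩

theorem IsMonomial.mul {r n : ℕ} {A B : Matrix (Fin n) (Fin n) ℂ}
    (hA : IsMonomial r A) (hB : IsMonomial r B) : IsMonomial r (A * B) := by
  have key : ∀ i j k, A i j ≠ 0 → (A * B) i k = A i j * B j k := by
    intro i j k hij
    rw [Matrix.mul_apply]
    refine Finset.sum_eq_single j (fun b _ hb => ?_) (by simp)
    have : A i b = 0 := by
      by_contra hk
      exact hb ((hA.row i).unique hk hij)
    simp [this]
  refine ⟨fun i k hik => ?_, fun i => ?_, fun k => ?_⟩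
  · obtain ⟨j, hj, -⟩ := hA.row i
    rw [key i j k hj] at hik ⊢
    rw [mul_pow, hA.root i j hj, hB.root j k (right_ne_zero_of_mul hik), one_mul]
  · obtain ⟨j, hj, -⟩ := hA.row i
    obtain ⟨k, hk, hu⟩ := hB.row j
    refine ⟨k, ?_, fun l hl => hu l ?_⟩
    · simp only [key i j k hj]
      exact mul_ne_zero hj hk
    · simp only [key i j l hj] at hl
      exact right_ne_zero_of_mul hl
  · obtain ⟨j, hj, hju⟩ := hB.col k
    obtain ⟨i, hi, hu⟩ := hA.col j
    refine ⟨i, ?_, fun l hl => hu l ?_⟩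
    · simp only [key i j k hi]
      exact mul_ne_zero hi hj
    · obtain ⟨m, hm, -⟩ := hA.row l
      simp only [key l m k hm] at hl
      rw [← hju m (right_ne_zero_of_mul hl)]
      exact hm

theorem IsMonomial.coe_inv {r n : ℕ} {A : GL (Fin n) ℂ}
    (h : IsMonomial r (A : Matrix (Fin n) (Fin n) ℂ)) :
    ((A⁻¹ : GL (Fin n) ℂ) : Matrix (Fin n) (Fin n) ℂ) = invT A := by
  rw [Matrix.coe_units_inv]
  exact Matrix.inv_eq_right_inv h.mul_invT

/-- The wreath product group `G(r,n)`, as a subgroup of `GL_n(ℂ)`. -/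
def G (r n : ℕ) : Subgroup (GL (Fin n) ℂ) where
  carrier := {A | IsMonomial r (A : Matrix (Fin n) (Fin n) ℂ)}
  mul_mem' hA hB := IsMonomial.mul hA hB
  one_mem' := IsMonomial.one r n
  inv_mem' {A} hA := by
    have hA : IsMonomial r (A : Matrix (Fin n) (Fin n) ℂ) := hA
    change IsMonomial r ((A⁻¹ : GL (Fin n) ℂ) : Matrix (Fin n) (Fin n) ℂ)
    rw [hA.coe_inv]
    exact hA.isMonomial_invT

/-- The underlying complex matrix of an element of `G(r,n)`. -/
def mat {r n : ℕ} (g : G r n) : Matrix (Fin n) (Fin n) ℂ := ((g : GL (Fin n) ℂ) : Matrix _ _ ℂ)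

theorem mat_isMonomial {r n : ℕ} (g : G r n) : IsMonomial r (mat g) := g.2

theorem mat_injective {r n : ℕ} : Function.Injective (mat (r := r) (n := n)) :=
  fun _ _ h => Subtype.ext (Units.ext h)

/-- A matrix with the defining properties of `G(r,n)`, as an element of `G(r,n)`. -/
def ofMat {r n : ℕ} (A : Matrix (Fin n) (Fin n) ℂ) (h : IsMonomial r A) : G r n :=
  ⟨⟨A, invT A, h.mul_invT, mul_eq_one_comm.mp h.mul_invT⟩, h⟩

/-- The complex conjugate `ḡ` of `g`. -/
def bar {r n : ℕ} (g : G r n) : G r n :=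
  ofMat ((mat g).map (starRingEnd ℂ))
    ⟨fun i j h => by
        have h' : mat g i j ≠ 0 := by simpa using h
        simp only [Matrix.map_apply]
        rw [← map_pow, (mat_isMonomial g).root i j h', map_one],
      fun i => by simpa using (mat_isMonomial g).row i,
      fun i => by simpa using (mat_isMonomial g).col i⟩

/-- The matrix `|g|` of absolute values of the entries of `g`, as an element of `G(r,n)`. -/
def absMat {r n : ℕ} [NeZero r] (g : G r n) : G r n :=
  ofMat ((mat g).map fun x => ((‖x‖ : ℝ) : ℂ))
    ⟨fun i j h => by
        have h' : mat g i j ≠ 0 := by simpa using h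
        simp only [Matrix.map_apply]
        rw [Complex.norm_eq_one_of_pow_eq_one ((mat_isMonomial g).root i j h') (NeZero.ne r)]
        simp,
      fun i => by simpa using (mat_isMonomial g).row i,
      fun i => by simpa using (mat_isMonomial g).col i⟩

/-- The function underlying the permutation `|g|`: `i` is sent to the row of the non-zero entry in
column `i`, so that `g e_i` is a multiple of `e_{|g|(i)}`. -/
def permFun {r n : ℕ} (g : G r n) (i : Fin n) : Fin n := ((mat_isMonomial g).col i).choose

theorem permFun_spec {r n : ℕ} (g : G r n) (i : Fin n) : mat g (permFun g i) i ≠ 0 :=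
  ((mat_isMonomial g).col i).choose_spec.1

theorem permFun_injective {r n : ℕ} (g : G r n) : Function.Injective (permFun g) := by
  intro i j h
  have hj := permFun_spec g j
  rw [← h] at hj
  exact ((mat_isMonomial g).row _).unique (permFun_spec g i) hj

/-- The permutation `|g|` of `{1, …, n}`: `|g|(i) = j` where `g_{j,i} ≠ 0`. -/
def perm {r n : ℕ} (g : G r n) : Equiv.Perm (Fin n) :=
  Equiv.ofBijective (permFun g) (Finite.injective_iff_bijective.mp (permFun_injective g))

theorem exists_color {r n : ℕ} [NeZero r] (g : G r n) (i : Fin n) :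
    ∃ k : ZMod r, mat g (perm g i) i = zeta r ^ k.val := by
  have hz : IsPrimitiveRoot (zeta r) r := Complex.isPrimitiveRoot_exp r (NeZero.ne r)
  obtain ⟨k, hk, h⟩ := hz.eq_pow_of_pow_eq_one
    ((mat_isMonomial g).root (perm g i) i (permFun_spec g i))
  refine ⟨(k : ZMod r), ?_⟩
  rw [ZMod.val_natCast_of_lt hk, h]

/-- The `i`-th color `z_i(g) ∈ ℤ/r`: `g e_i = ζ_r^{z_i(g)} e_{|g|(i)}`. -/
def color {r n : ℕ} [NeZero r] (g : G r n) (i : Fin n) : ZMod r := (exists_color g i).choose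

/-- The pairing `⟨g, g'⟩ = ∑ i, z_i(g) z_i(g') ∈ ℤ/r`. -/
def pairing {r n : ℕ} [NeZero r] (g g' : G r n) : ZMod r := ∑ i, color g i * color g' i

/-- `inv_τ(σ)`: the number of pairs `{i, j}` that are interchanged by `τ` and are inversions
of `σ` (each unordered pair is listed once, with `i < j`). -/
def invPerm {n : ℕ} (τ σ : Equiv.Perm (Fin n)) : ℕ :=
  (Finset.univ.filter fun p : Fin n × Fin n => p.1 < p.2 ∧ τ p.1 = p.2 ∧ σ p.2 < σ p.1).card

/-- The set `I(r,n)` of absolute involutions of `G(r,n)`. -/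
def absInvolutions (r n : ℕ) : Set (G r n) := {v | v * bar v = 1}

theorem mat_mul {r n : ℕ} (g h : G r n) : mat (g * h) = mat g * mat h := rfl

theorem bar_mul {r n : ℕ} (g h : G r n) : bar (g * h) = bar g * bar h := by
  apply mat_injective
  rw [mat_mul]
  exact Matrix.map_mul

theorem bar_one {r n : ℕ} : bar (1 : G r n) = 1 := by
  have h := bar_mul (1 : G r n) 1
  rw [one_mul] at h
  exact left_eq_mul.mp h

theorem bar_inv {r n : ℕ} (g : G r n) : bar g⁻¹ = (bar g)⁻¹ := by
  rw [eq_inv_iff_mul_eq_one, ← bar_mul, inv_mul_cancel, bar_one]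

theorem bar_absMat {r n : ℕ} [NeZero r] (g : G r n) : bar (absMat g) = absMat g := by
  apply mat_injective
  ext i j
  exact Complex.conj_ofReal _

/-- The absolute involution `|g| v |g|⁻¹`. -/
def absConj {r n : ℕ} [NeZero r] (g : G r n) (v : absInvolutions r n) : absInvolutions r n :=
  ⟨absMat g * (v : G r n) * (absMat g)⁻¹, by
    have hv : (v : G r n) * bar v = 1 := v.2
    change _ * bar _ = 1
    rw [bar_mul, bar_mul, bar_inv, bar_absMat]
    calc absMat g * (v : G r n) * (absMat g)⁻¹ * (absMat g * bar (v : G r n) * (absMat g)⁻¹)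
        = absMat g * ((v : G r n) * bar (v : G r n)) * (absMat g)⁻¹ := by group
      _ = 1 := by rw [hv]; group⟩

open Classical in
/-- A complex representation `ρ` of a group `Γ` is a `Γ`-model if it is the (internal) direct sum of
irreducible subrepresentations, among which every irreducible complex representation of `Γ` occurs,
up to isomorphism, exactly once. (Every irreducible representation of `Γ` is a quotient of the group
algebra, so that it is enough to consider those in the universe of `Γ`.) -/
def IsModel.{u, w} {Γ : Type u} [Group Γ] {V : Type w} [AddCommGroup V] [Module ℂ V]
    (ρ : Representation ℂ Γ V) : Prop :=
  ∃ S : Set (Subrepresentation ρ),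
    DirectSum.IsInternal (fun W : S => (W : Subrepresentation ρ).toSubmodule) ∧
    (∀ W ∈ S, W.toRepresentation.IsIrreducible) ∧
    ∀ (U : Type u) [AddCommGroup U] [Module ℂ U] (σ : Representation ℂ Γ U), σ.IsIrreducible →
      ∃! W : Subrepresentation ρ, W ∈ S ∧ Nonempty (σ.Equiv W.toRepresentation)

end WreathModel

end

/-! Two facts about the algebra E of intertwining endomorphisms of M suffice: E is commutative, and
dim E is at least the number of conjugacy classes of G. Commutativity makes isomorphic irreducible
submodules equal, so M is the direct sum of its irreducible submodules, and by Schur's lemma E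
embeds into the functions on the set of these. Irreducible characters are linearly independent class
functions; an irreducible representation missing from M would therefore give (irreducibles in M) + 1
≤ (classes) ≤ dim E ≤ (irreducibles in M). This is `isModel_of_commute`.

Commutativity is Gelfand's trick: every intertwiner has a symmetric matrix in the basis C_v
(`intertwining_symm`). For a pair v, w one needs either a g fixing both with different coefficients,
which kills both entries, or a g exchanging them with equal coefficients. If the colors differ, a
diagonal g of the first kind exists. If they agree, the orbits of the group generated by |v| and |w|
are paths and closed polygons. A path with an even number 2m of vertices has both ends fixed by the
same involution; its reversal commutes with both and inverts m - 1 pairs of one and m of the other,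
so the signs differ (`exists_invSign_ne`). If no such path occurs, suitable reflections of the
orbits exchange |v| and |w| (`exists_swap`).

For the dimension, averaging the elementary map C_v ↦ C_w gives a nonzero intertwiner as soon as the
common stabilizer of v and w acts on both by the same coefficients. Given g, split each cycle of |g|
alternately into two involutions with a common transversal, colored by the color sums of the cycles
of g. The sign on the centralizer is computed from the transversal alone, so the pair is admissible;
the pair also recovers the cycle type and cycle colors, hence the class of g
(`exists_admissible_pairs`). -/

open scoped Matrix

noncomputable section

namespace WreathModel

/-! ### Semisimple modules with commutative endomorphism ring -/

section CommutingEndomorphisms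

variable {R M : Type*} [Ring R] [AddCommGroup M] [Module R M] [IsSemisimpleModule R M]

/-- If the endomorphisms of a semisimple module commute, then isomorphic simple submodules
are equal. -/
theorem eq_of_linearEquiv_of_commute (hc : ∀ f f' : Module.End R M, f * f' = f' * f)
    (N N' : Submodule R M) [IsSimpleModule R N] [IsSimpleModule R N'] (φ : N ≃ₗ[R] N') :
    N = N' := by
  obtain ⟨Q, hQ⟩ := exists_isCompl N
  -- The endomorphisms `p` and `φ ∘ p` commute. At `φ⁻¹ y` one order of composition gives `p y`, the
  -- other gives `y`; hence `y` lies in `N`.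
  let p : M →ₗ[R] N := Submodule.projectionOnto N Q hQ
  have hp : ∀ x : N, p x = x := fun x => Submodule.projectionOnto_apply_left hQ x
  have h := hc (N.subtype ∘ₗ p) (N'.subtype ∘ₗ φ.toLinearMap ∘ₗ p)
  have hle : N' ≤ N := by
    intro y hy
    have hx := LinearMap.congr_fun h (φ.symm ⟨y, hy⟩ : M)
    simp only [Module.End.mul_apply, LinearMap.comp_apply, hp, Submodule.subtype_apply,
      LinearEquiv.coe_coe, LinearEquiv.apply_symm_apply] at hx
    rw [← hx]
    exact (p y).2
  exact (((isSimpleModule_iff_isAtom.mp ‹IsSimpleModule R N›).le_iff_eq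
    (isSimpleModule_iff_isAtom.mp ‹IsSimpleModule R N'›).1).mp hle).symm

/-- Isotypic components are always independent, and here each simple submodule is a whole isotypic
component. -/
theorem sSupIndep_simples_of_commute (hc : ∀ f f' : Module.End R M, f * f' = f' * f) :
    sSupIndep {N : Submodule R M | IsSimpleModule R N} := by
  refine sSupIndep.mono (sSupIndep_isotypicComponents R M) fun N (hN : IsSimpleModule R N) =>
    ⟨N, hN, le_antisymm N.le_isotypicComponent (sSup_le ?_)⟩
  rintro N' ⟨e⟩
  have := IsSimpleModule.congr e
  exact (eq_of_linearEquiv_of_commute hc N' N e).le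

end CommutingEndomorphisms

/-! ### Counting irreducibles by characters and by intertwiners -/

section Model

variable {Γ V : Type*} [Group Γ] [AddCommGroup V] [Module ℂ V]
  {ρ : Representation ℂ Γ V}

/-- The inclusion of a subrepresentation. -/
def subrepresentationInclusion (W : Subrepresentation ρ) :
    Representation.IntertwiningMap W.toRepresentation ρ :=
  ⟨W.toSubmodule.subtype, fun _ => rfl⟩

/-- The module of a subrepresentation is the corresponding submodule. -/
def asSubmoduleEquiv (W : Subrepresentation ρ) :
    W.toRepresentation.asModule ≃ₗ[MonoidAlgebra ℂ Γ] W.asSubmodule :=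
  (LinearEquiv.ofInjective (Representation.IntertwiningMap.equivLinearMapAsModule _ _
    (subrepresentationInclusion W)) Subtype.val_injective).trans
    (LinearEquiv.ofEq _ _ (SetLike.coe_injective Subtype.range_coe))

theorem isSimpleModule_asSubmodule_iff (W : Subrepresentation ρ) :
    IsSimpleModule (MonoidAlgebra ℂ Γ) W.asSubmodule ↔ W.toRepresentation.IsIrreducible := by
  rw [Representation.irreducible_iff_isSimpleModule_asModule]
  exact (asSubmoduleEquiv W).symm.isSimpleModule_iff

theorem commute_end_asModule
    (hc : ∀ f f' : Representation.IntertwiningMap ρ ρ, f * f' = f' * f)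
    (f f' : Module.End (MonoidAlgebra ℂ Γ) ρ.asModule) : f * f' = f' * f := by
  obtain ⟨f, rfl⟩ := (Representation.IntertwiningMap.equivAlgEnd (ρ := ρ)).surjective f
  obtain ⟨f', rfl⟩ := (Representation.IntertwiningMap.equivAlgEnd (ρ := ρ)).surjective f'
  rw [← map_mul, hc, map_mul]

variable [Finite Γ]

instance : IsSemisimpleModule (MonoidAlgebra ℂ Γ) ρ.asModule := by
  have : NeZero (Nat.card Γ : ℂ) := ⟨Nat.cast_ne_zero.mpr Nat.card_pos.ne'⟩
  infer_instance

theorem eq_of_equiv_of_commute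
    (hc : ∀ f f' : Representation.IntertwiningMap ρ ρ, f * f' = f' * f)
    (W W' : Subrepresentation ρ) (hW : W.toRepresentation.IsIrreducible)
    (hW' : W'.toRepresentation.IsIrreducible)
    (φ : W.toRepresentation.Equiv W'.toRepresentation) : W = W' := by
  have h1 := (isSimpleModule_asSubmodule_iff W).mpr hW
  have h2 := (isSimpleModule_asSubmodule_iff W').mpr hW'
  have e : W.asSubmodule ≃ₗ[MonoidAlgebra ℂ Γ] W'.asSubmodule :=
    (asSubmoduleEquiv W).symm.trans (((LinearEquiv.ofBijective
      (Representation.IntertwiningMap.equivLinearMapAsModule _ _ φ.toIntertwiningMap)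
      φ.toLinearEquiv.bijective)).trans (asSubmoduleEquiv W'))
  exact Subrepresentation.subrepresentationSubmoduleOrderIso.injective
    (eq_of_linearEquiv_of_commute (N := W.asSubmodule) (N' := W'.asSubmodule) (commute_end_asModule hc) e)

theorem isInternal_irreducibles_of_commute
    [DecidableEq {W : Subrepresentation ρ | W.toRepresentation.IsIrreducible}]
    (hc : ∀ f f' : Representation.IntertwiningMap ρ ρ, f * f' = f' * f) :
    DirectSum.IsInternal (fun W : {W : Subrepresentation ρ | W.toRepresentation.IsIrreducible} =>
      (W : Subrepresentation ρ).toSubmodule) := by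
  have key : DirectSum.IsInternal
      (fun W : {W : Subrepresentation ρ | W.toRepresentation.IsIrreducible} =>
        (W : Subrepresentation ρ).asSubmodule) := by
    refine DirectSum.isInternal_submodule_of_iSupIndep_of_iSup_eq_top ?_ ?_
    · have h := (sSupIndep_iff _).mp (sSupIndep_simples_of_commute
        (R := MonoidAlgebra ℂ Γ) (M := ρ.asModule) (commute_end_asModule hc))
      let F : {W : Subrepresentation ρ | W.toRepresentation.IsIrreducible} →
          {N : Submodule (MonoidAlgebra ℂ Γ) ρ.asModule |
            IsSimpleModule (MonoidAlgebra ℂ Γ) N} :=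
        fun W => ⟨W.1.asSubmodule, (isSimpleModule_asSubmodule_iff W.1).mpr W.2⟩
      exact h.comp (f := F) fun a b hab => Subtype.ext
        (Subrepresentation.subrepresentationSubmoduleOrderIso.injective (Subtype.ext_iff.mp hab))
    · rw [eq_top_iff, ← IsSemisimpleModule.sSup_simples_eq_top (MonoidAlgebra ℂ Γ) ρ.asModule]
      refine sSup_le fun N hN => ?_
      have h2 : (Subrepresentation.ofSubmodule' N).asSubmodule = N := rfl
      have h3 : (Subrepresentation.ofSubmodule' N).toRepresentation.IsIrreducible := by
        rw [← isSimpleModule_asSubmodule_iff, h2]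
        exact hN
      exact le_iSup (fun W : {W : Subrepresentation ρ | W.toRepresentation.IsIrreducible} =>
        (W : Subrepresentation ρ).asSubmodule) ⟨_, h3⟩
  exact key

/-- Intertwining endomorphisms act by scalars on the irreducible subrepresentations, if they
commute. -/
theorem exists_scalar_of_commute [FiniteDimensional ℂ V]
    (hc : ∀ f f' : Representation.IntertwiningMap ρ ρ, f * f' = f' * f)
    (W : Subrepresentation ρ) (hW : W.toRepresentation.IsIrreducible)
    (f : Representation.IntertwiningMap ρ ρ) :
    ∃ c : ℂ, ∀ x ∈ W.toSubmodule, f x = c • x := by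
  have h1 := (isSimpleModule_asSubmodule_iff W).mpr hW
  have hle : ∀ x ∈ W.toSubmodule, f x ∈ W.toSubmodule := by
    -- By simplicity `f` is zero or injective on `W`. In the second case its image is isomorphic to
    -- `W`, hence equal to `W`.
    let F : W.asSubmodule →ₗ[MonoidAlgebra ℂ Γ] ρ.asModule :=
      (Representation.IntertwiningMap.equivAlgEnd (ρ := ρ) f).comp W.asSubmodule.subtype
    rcases LinearMap.injective_or_eq_zero F with hF | hF
    · have e := LinearEquiv.ofInjective F hF
      have := IsSimpleModule.congr e.symm
      have heq := eq_of_linearEquiv_of_commute (commute_end_asModule hc) _ _ e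
      intro x hx
      have hx2 : F ⟨x, hx⟩ ∈ LinearMap.range F := ⟨_, rfl⟩
      rw [← heq] at hx2
      exact hx2
    · intro x hx
      have : f x = 0 := LinearMap.congr_fun hF ⟨x, hx⟩
      rw [this]
      exact zero_mem _
  let f' : Representation.IntertwiningMap W.toRepresentation W.toRepresentation :=
    { toLinearMap := f.toLinearMap.restrict hle
      isIntertwining' := fun g => by
        ext x
        exact Representation.IntertwiningMap.isIntertwining _ _ f g x }
  obtain ⟨c, hcc⟩ :=
    (Representation.IsIrreducible.algebraMap_intertwiningMap_bijective_of_isAlgClosed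
      (ρ := W.toRepresentation)).2 f'
  refine ⟨c, fun x hx => ?_⟩
  have h2 := congrArg (fun F : Representation.IntertwiningMap W.toRepresentation
    W.toRepresentation => ((F ⟨x, hx⟩ : W.toSubmodule) : V)) hcc
  rw [Algebra.algebraMap_eq_smul_one] at h2
  exact h2.symm

/-- The finite orbit of a nonzero vector spans a nonzero subrepresentation, which must be
everything. -/
theorem finiteDimensional_of_isIrreducible {U : Type*} [AddCommGroup U] [Module ℂ U]
    (σ : Representation ℂ Γ U) (hσ : σ.IsIrreducible) : FiniteDimensional ℂ U := by
  obtain ⟨W, hW⟩ : ∃ W : Subrepresentation σ, W ≠ ⊥ := ⟨⊤, top_ne_bot⟩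
  obtain ⟨u, -, hu⟩ : ∃ u ∈ W.toSubmodule, u ≠ 0 := by
    by_contra! h
    refine hW (Subrepresentation.toSubmodule_injective ?_)
    exact (Submodule.eq_bot_iff _).mpr h
  let N : Subrepresentation σ :=
    { toSubmodule := Submodule.span ℂ (Set.range fun g => σ g u)
      apply_mem_toSubmodule := fun g v hv => by
        induction hv using Submodule.span_induction with
        | mem x hx =>
          obtain ⟨h, rfl⟩ := hx
          refine Submodule.subset_span ⟨g * h, ?_⟩
          simp
        | zero => simp
        | add x y _ _ hx hy => rw [map_add]; exact add_mem hx hy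
        | smul c x _ hx => rw [map_smul]; exact Submodule.smul_mem _ c hx }
  have hN : N = ⊤ := by
    refine (IsSimpleOrder.eq_bot_or_eq_top N).resolve_left fun h => hu ?_
    have h1 : u ∈ N.toSubmodule := Submodule.subset_span ⟨1, by simp⟩
    rw [h] at h1
    exact h1
  have h2 : (⊤ : Submodule ℂ U) = Submodule.span ℂ (Set.range fun g => σ g u) :=
    (congrArg Subrepresentation.toSubmodule hN).symm
  exact ⟨h2 ▸ Submodule.fg_span (Set.finite_range _)⟩

/-- The character, as a function on the conjugacy classes. -/
def classCharacter {U : Type*} [AddCommGroup U] [Module ℂ U] (σ : Representation ℂ Γ U) :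
    ConjClasses Γ → ℂ :=
  Quotient.lift σ.character fun a b h => by
    obtain ⟨c, rfl⟩ := isConj_iff.mp h
    exact (σ.char_conj a c).symm

/-- The characters of pairwise non-isomorphic irreducible representations are linearly
independent. -/
theorem linearIndependent_classCharacter {ι : Type*} {U : ι → Type*} [∀ i, AddCommGroup (U i)]
    [∀ i, Module ℂ (U i)] (σ : ∀ i, Representation ℂ Γ (U i)) (hσ : ∀ i, (σ i).IsIrreducible)
    (hne : ∀ i j, Nonempty ((σ i).Equiv (σ j)) → i = j) :
    LinearIndependent ℂ fun i => classCharacter (σ i) := by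
  classical
  have := Fintype.ofFinite Γ
  have hcard : (Nat.card Γ : ℂ) ≠ 0 := Nat.cast_ne_zero.mpr Nat.card_pos.ne'
  have := invertibleOfNonzero hcard
  have hfin := fun i => finiteDimensional_of_isIrreducible (σ i) (hσ i)
  rw [linearIndependent_iff']
  intro s a hs j hj
  -- Pairing with the character of `σ j`; by orthonormality it extracts the coefficient of index `j`
  -- from a linear relation.
  let B : (ConjClasses Γ → ℂ) → ℂ := fun φ =>
    (Nat.card Γ : ℂ)⁻¹ * ∑ g : Γ, φ (ConjClasses.mk g) * (σ j).character g⁻¹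
  have hB : ∀ i, B (classCharacter (σ i)) = if i = j then 1 else 0 := by
    intro i
    have := hσ i
    have := hσ j
    have h := Representation.char_orthonormal (σ i) (σ j)
    have h2 : Nonempty ((σ j).Equiv (σ i)) ↔ i = j := by
      refine ⟨fun h => (hne j i h).symm, ?_⟩
      rintro rfl
      exact ⟨Representation.Equiv.refl _⟩
    simp only [h2] at h
    exact h
  have h0 : B (∑ i ∈ s, a i • classCharacter (σ i)) = ∑ i ∈ s, a i * B (classCharacter (σ i)) := by
    simp only [B, Finset.sum_apply, Pi.smul_apply, smul_eq_mul, Finset.sum_mul, Finset.mul_sum]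
    rw [Finset.sum_comm]
    refine Finset.sum_congr rfl fun i _ => Finset.sum_congr rfl fun g _ => ?_
    ring
  rw [hs] at h0
  simp only [hB] at h0
  simpa [B, hj] using h0.symm

/-- If the intertwining endomorphisms commute, their space has dimension at most the number of
irreducible subrepresentations. -/
theorem finrank_intertwiningMap_le_of_commute [FiniteDimensional ℂ V]
    [Fintype {W : Subrepresentation ρ | W.toRepresentation.IsIrreducible}]
    (hc : ∀ f f' : Representation.IntertwiningMap ρ ρ, f * f' = f' * f) :
    Module.finrank ℂ (Representation.IntertwiningMap ρ ρ) ≤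
      Fintype.card {W : Subrepresentation ρ | W.toRepresentation.IsIrreducible} := by
  classical
  choose c hcs using fun W : {W : Subrepresentation ρ | W.toRepresentation.IsIrreducible} =>
    exists_scalar_of_commute hc W.1 W.2
  have hx : ∀ W : {W : Subrepresentation ρ | W.toRepresentation.IsIrreducible},
      ∃ x ∈ W.1.toSubmodule, x ≠ 0 := fun W => by
    by_contra! h
    have hW : W.1.toRepresentation.IsIrreducible := W.2
    have hss : Subsingleton W.1.toSubmodule :=
      ⟨fun a b => Subtype.ext ((h a a.2).trans (h b b.2).symm)⟩
    refine bot_ne_top (α := Subrepresentation W.1.toRepresentation) ?_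
    ext x
    exact ⟨fun _ => Submodule.mem_top, fun _ => by
      rw [hss.elim x 0]
      exact zero_mem _⟩
  choose x hxm hx0 using hx
  let L : Representation.IntertwiningMap ρ ρ →ₗ[ℂ]
      ({W : Subrepresentation ρ | W.toRepresentation.IsIrreducible} → ℂ) :=
    { toFun := fun f W => c W f
      map_add' := fun f f' => by
        ext W
        refine smul_left_injective ℂ (hx0 W) ?_
        simp only [Pi.add_apply, add_smul]
        rw [← hcs W _ _ (hxm W), ← hcs W _ _ (hxm W), ← hcs W _ _ (hxm W)]
        rfl
      map_smul' := fun a f => by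
        ext W
        refine smul_left_injective ℂ (hx0 W) ?_
        simp only [Pi.smul_apply, RingHom.id_apply, smul_assoc]
        rw [← hcs W _ _ (hxm W), ← hcs W _ _ (hxm W)]
        rfl }
  have hL : Function.Injective L := by
    rw [← LinearMap.ker_eq_bot, LinearMap.ker_eq_bot']
    intro f hf
    -- If all the scalars of `f` vanish, `f` kills every irreducible subrepresentation, and these
    -- span.
    have hker : (⊤ : Submodule ℂ V) ≤ LinearMap.ker f.toLinearMap := by
      rw [← (isInternal_irreducibles_of_commute hc).submodule_iSup_eq_top]
      refine iSup_le fun W y hy => ?_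
      rw [LinearMap.mem_ker]
      have h1 : f y = c W f • y := hcs W f y hy
      have h2 : c W f = 0 := congrFun hf W
      rw [h2, zero_smul] at h1
      exact h1
    ext y
    exact hker Submodule.mem_top
  have h := LinearMap.finrank_le_finrank_of_injective hL
  rwa [Module.finrank_fintype_fun_eq_card] at h

end Model

/-- A finite-dimensional representation is a model if its intertwining endomorphisms commute and
there are at least as many linearly independent ones as conjugacy classes. -/
theorem isModel_of_commute {Γ V : Type} [Group Γ] [Finite Γ] [AddCommGroup V] [Module ℂ V]
    {ρ : Representation ℂ Γ V} [FiniteDimensional ℂ V]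
    (hc : ∀ f f' : Representation.IntertwiningMap ρ ρ, f * f' = f' * f)
    (F : ConjClasses Γ → Representation.IntertwiningMap ρ ρ) (hF : LinearIndependent ℂ F) :
    IsModel ρ := by
  classical
  have hint := isInternal_irreducibles_of_commute hc
  refine ⟨{W : Subrepresentation ρ | W.toRepresentation.IsIrreducible}, hint, fun W hW => hW, ?_⟩
  intro U _ _ σ hσ
  suffices h : ∃ W : Subrepresentation ρ, W.toRepresentation.IsIrreducible ∧
      Nonempty (σ.Equiv W.toRepresentation) by
    obtain ⟨W, hW, ⟨e⟩⟩ := h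
    exact ⟨W, ⟨hW, ⟨e⟩⟩, fun W' ⟨hW', ⟨e'⟩⟩ =>
      eq_of_equiv_of_commute hc W' W hW' hW (e'.symm.trans e)⟩
  by_contra! hno
  -- Adjoining the missing `σ` to the irreducible subrepresentations gives one more independent
  -- class function than the dimension count allows.
  let A : Option {W : Subrepresentation ρ | W.toRepresentation.IsIrreducible} → Rep.{0} ℂ Γ :=
    fun i => i.elim (Rep.of σ) fun W => Rep.of W.1.toRepresentation
  have hli := linearIndependent_classCharacter (fun i => (A i).ρ)
    (by
      rintro (_ | W)
      · exact hσ
      · exact W.2)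
    (by
      rintro (_ | W) (_ | W') ⟨e⟩
      · rfl
      · exact ((hno W'.1 W'.2).false e).elim
      · exact ((hno W.1 W.2).false e.symm).elim
      · exact congrArg some (Subtype.ext (eq_of_equiv_of_commute hc W.1 W'.1 W.2 W'.2 e)))
  have := Fintype.ofFinite (ConjClasses Γ)
  have hfin := hli.finite
  have hfin' : Finite {W : Subrepresentation ρ | W.toRepresentation.IsIrreducible} :=
    Finite.of_injective some (Option.some_injective _)
  have := Fintype.ofFinite {W : Subrepresentation ρ | W.toRepresentation.IsIrreducible}
  have h1 := hli.fintype_card_le_finrank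
  rw [Module.finrank_fintype_fun_eq_card, Fintype.card_option] at h1
  have h2 := hF.fintype_card_le_finrank
  have h3 := finrank_intertwiningMap_le_of_commute hc
  omega

/-! ### Transversals of the 2-cycles of an involution -/

section Transversals

variable {X : Type*}

/-- `O` contains exactly one element of each `2`-cycle of `τ`, and no fixed point. -/
structure IsTransversal (τ : Equiv.Perm X) (O : Finset X) : Prop where
  fixed : ∀ x, τ x = x → x ∉ O
  moved : ∀ x, τ x ≠ x → (x ∈ O ↔ τ x ∉ O)

/-- Two transversals differ only by replacing some `x` by `τ x`, which does not change an invariant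
factor. -/
theorem IsTransversal.prod_eq [DecidableEq X] {M : Type*} [CommMonoid M] {τ : Equiv.Perm X}
    (hτ : ∀ x, τ (τ x) = x) {O O' : Finset X} (hO : IsTransversal τ O)
    (hO' : IsTransversal τ O') (f : X → M) (hf : ∀ x, f (τ x) = f x) :
    ∏ x ∈ O, f x = ∏ x ∈ O', f x := by
  have key : ∀ {P P' : Finset X}, IsTransversal τ P → IsTransversal τ P' → ∀ x ∈ P,
      (if x ∈ P' then x else τ x) ∈ P' ∧
      (if (if x ∈ P' then x else τ x) ∈ P then (if x ∈ P' then x else τ x)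
        else τ (if x ∈ P' then x else τ x)) = x := by
    intro P P' hP hP' x hx
    have hx1 : τ x ≠ x := fun h => hP.fixed x h hx
    have hx2 := (hP.moved x hx1).mp hx
    by_cases hx' : x ∈ P'
    · simp [hx, hx']
    · have := hP'.moved x hx1
      simp only [hx', if_false, hx2, hτ, and_true]
      tauto
  refine Finset.prod_nbij' (fun x => if x ∈ O' then x else τ x)
    (fun x => if x ∈ O then x else τ x) (fun x hx => (key hO hO' x hx).1)
    (fun x hx => (key hO' hO x hx).1) (fun x hx => (key hO hO' x hx).2)
    (fun x hx => (key hO' hO x hx).2) fun x _ => ?_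
  split_ifs
  · rfl
  · rw [hf]

theorem IsTransversal.map {τ : Equiv.Perm X} {O : Finset X} (hO : IsTransversal τ O)
    (σ : Equiv.Perm X) : IsTransversal (σ * τ * σ⁻¹) (O.map σ.toEmbedding) where
  fixed x hx h := by
    rw [Finset.mem_map_equiv] at h
    refine hO.fixed _ ?_ h
    rw [Equiv.Perm.mul_apply, Equiv.Perm.mul_apply, ← Equiv.Perm.eq_inv_iff_eq] at hx
    exact hx
  moved x hx := by
    rw [Finset.mem_map_equiv, Finset.mem_map_equiv]
    have h := hO.moved (σ⁻¹ x) (fun h => hx (by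
      change σ (τ (σ⁻¹ x)) = x
      rw [h]
      exact σ.apply_symm_apply x))
    simpa [Equiv.Perm.mul_apply] using h

end Transversals

/-! ### The inversion sign attached to an involution -/

section InvSign

variable {n : ℕ}

/-- The sign `(-1)^{inv_τ(σ)}`. -/
def invSign (τ σ : Equiv.Perm (Fin n)) : ℤ := (-1) ^ invPerm τ σ

/-- The sign of the order of a pair. -/
def orderSign (a b : Fin n) : ℤ := if a < b then 1 else -1

theorem orderSign_mul_self (a b : Fin n) : orderSign a b * orderSign a b = 1 := by
  unfold orderSign
  split_ifs <;> rfl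

theorem orderSign_swap {a b : Fin n} (h : a ≠ b) : orderSign b a = -orderSign a b := by
  unfold orderSign
  rcases lt_or_gt_of_ne h with h | h
  · simp [h, h.not_gt]
  · simp [h, h.not_gt]

/-- Whether `σ` inverts the pair `x, τ x`. -/
def pairSign (τ σ : Equiv.Perm (Fin n)) (x : Fin n) : ℤ :=
  orderSign x (τ x) * orderSign (σ x) (σ (τ x))

theorem pairSign_apply {τ : Equiv.Perm (Fin n)} (hτ : ∀ x, τ (τ x) = x)
    (σ : Equiv.Perm (Fin n)) (x : Fin n) : pairSign τ σ (τ x) = pairSign τ σ x := by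
  by_cases h : τ x = x
  · rw [h]
  · unfold pairSign
    rw [hτ, orderSign_swap (Ne.symm h), orderSign_swap (a := σ x) (b := σ (τ x))]
    · ring
    · exact fun h' => h (σ.injective h').symm

theorem isTransversal_lt {τ : Equiv.Perm (Fin n)} (hτ : ∀ x, τ (τ x) = x) :
    IsTransversal τ (Finset.univ.filter fun x => x < τ x) where
  fixed x hx := by simp [hx]
  moved x hx := by
    simp only [Finset.mem_filter, Finset.mem_univ, true_and, hτ, not_lt]
    exact ⟨le_of_lt, fun h => lt_of_le_of_ne h (Ne.symm hx)⟩

/-- Whether a pair is inverted does not depend on the order of its two points, so any transversal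
may replace the one given by `x < τ x`. This freedom is what makes conjugation manageable. -/
theorem invSign_eq_prod {τ : Equiv.Perm (Fin n)} (hτ : ∀ x, τ (τ x) = x)
    (σ : Equiv.Perm (Fin n)) {O : Finset (Fin n)} (hO : IsTransversal τ O) :
    invSign τ σ = ∏ x ∈ O, pairSign τ σ x := by
  rw [hO.prod_eq hτ (isTransversal_lt hτ) _ (pairSign_apply hτ σ)]
  have h1 : ∀ x ∈ Finset.univ.filter (fun x => x < τ x),
      pairSign τ σ x = if σ (τ x) < σ x then -1 else 1 := by
    intro x hx
    have hx : x < τ x := (Finset.mem_filter.mp hx).2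
    have hne : σ (τ x) ≠ σ x := fun h => hx.ne (σ.injective h).symm
    unfold pairSign orderSign
    rw [if_pos hx, one_mul]
    rcases lt_or_gt_of_ne hne with h | h
    · rw [if_neg h.not_gt, if_pos h]
    · rw [if_pos h, if_neg h.not_gt]
  rw [Finset.prod_congr rfl h1, Finset.prod_ite, Finset.prod_const, Finset.prod_const_one, mul_one,
    invSign, Finset.filter_filter, invPerm]
  congr 1
  refine Finset.card_nbij' (fun p => p.1) (fun x => (x, τ x)) ?_ ?_ ?_ ?_
  · rintro ⟨x, y⟩ h
    simp only [Finset.coe_filter, Finset.mem_univ, true_and, Set.mem_ofPred_eq] at h ⊢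
    obtain ⟨h1, rfl, h2⟩ := h
    exact ⟨h1, h2⟩
  · intro x h
    simpa using h
  · rintro ⟨x, y⟩ h
    simp only [Finset.coe_filter, Finset.mem_univ, true_and, Set.mem_ofPred_eq] at h
    exact Prod.ext rfl h.2.1
  · intro x _
    rfl

/-- `inv_τ` is a cocycle modulo `2`. -/
theorem invSign_mul {τ : Equiv.Perm (Fin n)} (hτ : ∀ x, τ (τ x) = x)
    (σ' σ : Equiv.Perm (Fin n)) :
    invSign τ (σ' * σ) = invSign (σ * τ * σ⁻¹) σ' * invSign τ σ := by
  have hO := isTransversal_lt hτ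
  have hτ' : ∀ x, (σ * τ * σ⁻¹) ((σ * τ * σ⁻¹) x) = x := fun x => by
    simp [Equiv.Perm.mul_apply, hτ]
  rw [invSign_eq_prod hτ _ hO, invSign_eq_prod hτ _ hO, invSign_eq_prod hτ' _ (hO.map σ),
    Finset.prod_map, ← Finset.prod_mul_distrib]
  refine Finset.prod_congr rfl fun x _ => ?_
  -- The intermediate order of `σ x` and `σ (τ x)` enters both factors on the right and cancels.
  have := orderSign_mul_self (σ x) (σ (τ x))
  have hinv : σ⁻¹ (σ x) = x := σ.symm_apply_apply x
  simp only [pairSign, Equiv.coe_toEmbedding, Equiv.Perm.mul_apply, hinv]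
  linear_combination (-orderSign x (τ x) * orderSign (σ' (σ x)) (σ' (σ (τ x)))) * this

/-- The sign of an element of the centralizer of `τ`, in terms of any transversal. -/
theorem invSign_eq_prod_of_commute {τ : Equiv.Perm (Fin n)} (hτ : ∀ x, τ (τ x) = x)
    {σ : Equiv.Perm (Fin n)} (hσ : σ * τ = τ * σ) {O : Finset (Fin n)} (hO : IsTransversal τ O) :
    invSign τ σ = ∏ x ∈ O, if σ x ∈ O then 1 else -1 := by
  classical
  let s : Fin n → ℤ := fun x => if x ∈ O then 1 else -1
  -- `r` compares the orientation of a pair given by `O` with the numerical one. It depends only on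
  -- the pair, and `σ` permutes the pairs, so it drops out of the product over `O`.
  let r : Fin n → ℤ := fun x => s x * orderSign x (τ x)
  have hr : ∀ x, r (τ x) = r x := by
    intro x
    by_cases h : τ x = x
    · rw [h]
    · have h1 := hO.moved x h
      simp only [r, s, hτ, orderSign_swap (Ne.symm h)]
      by_cases hx : x ∈ O <;> simp_all
  have hs : ∀ x, s x * s x = 1 := fun x => by
    simp only [s]
    split_ifs <;> rfl
  have hrr : ∀ x, r x * r x = 1 := fun x => by
    have := hs x
    have := orderSign_mul_self x (τ x)
    simp only [r]
    linear_combination (orderSign x (τ x))^2 * hs x + this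
  have hcomm : ∀ x, σ (τ x) = τ (σ x) := fun x => congrArg (fun p : Equiv.Perm (Fin n) => p x) hσ
  have hmap := hO.map σ
  rw [hσ, mul_inv_cancel_right] at hmap
  have h1 : ∏ x ∈ O, r (σ x) = ∏ x ∈ O, r x := by
    rw [hO.prod_eq hτ hmap r hr, Finset.prod_map]
    rfl
  have h2 : ∀ x ∈ O, pairSign τ σ x = (r x * r (σ x)) * s (σ x) := by
    intro x hx
    have h3 : s x = 1 := if_pos hx
    have := hs (σ x)
    simp only [pairSign, r, h3, hcomm]
    linear_combination (-orderSign x (τ x) * orderSign (σ x) (τ (σ x))) * this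
  rw [invSign_eq_prod hτ σ hO, Finset.prod_congr rfl h2, Finset.prod_mul_distrib,
    Finset.prod_mul_distrib, h1, ← Finset.prod_mul_distrib, Finset.prod_congr rfl fun x _ => hrr x,
    Finset.prod_const_one, one_mul]

theorem invSign_one (τ : Equiv.Perm (Fin n)) : invSign τ 1 = 1 := by
  have : invPerm τ 1 = 0 := by
    unfold invPerm
    rw [Finset.card_eq_zero, Finset.filter_eq_empty_iff]
    rintro p - ⟨h1, -, h2⟩
    exact lt_asymm h1 h2
  rw [invSign, this, pow_zero]

theorem invSign_mul_self (τ σ : Equiv.Perm (Fin n)) : invSign τ σ * invSign τ σ = 1 := by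
  rw [invSign, ← mul_pow]
  simp

end InvSign

/-! ### The dihedral action of two involutions -/

section Dihedral

variable {X : Type*} {τ₁ τ₂ : Equiv.Perm X}

theorem zpow_apply_zpow_apply (p : Equiv.Perm X) (a b : ℤ) (x : X) :
    (p ^ a) ((p ^ b) x) = (p ^ (a + b)) x := by
  rw [zpow_add, Equiv.Perm.mul_apply]

theorem zpow_apply_eq_iff (p : Equiv.Perm X) (a b : ℤ) (x : X) :
    (p ^ a) x = (p ^ b) x ↔ (p ^ (a - b)) x = x := by
  constructor
  · intro h
    have := congrArg (p ^ (-b)) h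
    rw [zpow_apply_zpow_apply, zpow_apply_zpow_apply, neg_add_cancel, zpow_zero] at this
    rw [show a - b = -b + a by ring, this]
    rfl
  · intro h
    have := congrArg (p ^ b) h
    rwa [zpow_apply_zpow_apply, add_sub_cancel] at this

theorem zpow_mul_apply_eq_self {p : Equiv.Perm X} {a : ℤ} {x : X} (h : (p ^ a) x = x) (b : ℤ) :
    (p ^ (b * a)) x = x := by
  rw [mul_comm, zpow_mul]
  exact Function.IsFixedPt.perm_zpow (e := p ^ a) h b

/-- The dihedral relation: conjugation by `τ₁` inverts the rotation `τ₂ * τ₁`. -/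
theorem apply_zpow_mul_apply (h₁ : ∀ x, τ₁ (τ₁ x) = x) (h₂ : ∀ x, τ₂ (τ₂ x) = x) (k : ℤ) (x : X) :
    τ₁ (((τ₂ * τ₁) ^ k) x) = ((τ₂ * τ₁) ^ (-k)) (τ₁ x) := by
  have hi₁ : τ₁⁻¹ = τ₁ := inv_eq_of_mul_eq_one_left (Equiv.ext h₁)
  have hi₂ : τ₂⁻¹ = τ₂ := inv_eq_of_mul_eq_one_left (Equiv.ext h₂)
  have h : τ₁ * (τ₂ * τ₁) ^ k * τ₁⁻¹ = (τ₂ * τ₁) ^ (-k) := by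
    rw [← conj_zpow, zpow_neg, ← inv_zpow, mul_inv_rev, hi₁, hi₂]
    congr 1
    rw [← mul_assoc, mul_assoc _ τ₁ τ₁, show τ₁ * τ₁ = 1 from Equiv.ext h₁, mul_one]
  rw [← h, Equiv.Perm.mul_apply, Equiv.Perm.mul_apply, hi₁, h₁]

theorem apply_eq_zpow_apply (h₁ : ∀ x, τ₁ (τ₁ x) = x) (x : X) :
    τ₂ x = ((τ₂ * τ₁) ^ (1 : ℤ)) (τ₁ x) := by
  rw [zpow_one, Equiv.Perm.mul_apply, h₁]

/-- The orbits of the group generated by two involutions. -/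
def dihedralSetoid (h₁ : ∀ x, τ₁ (τ₁ x) = x) (h₂ : ∀ x, τ₂ (τ₂ x) = x) : Setoid X where
  r x y := ∃ k : ℤ, y = ((τ₂ * τ₁) ^ k) x ∨ y = ((τ₂ * τ₁) ^ k) (τ₁ x)
  iseqv :=
    { refl := fun x => ⟨0, Or.inl rfl⟩
      symm := by
        rintro x y ⟨k, rfl | rfl⟩
        · exact ⟨-k, Or.inl (by rw [zpow_apply_zpow_apply, neg_add_cancel]; rfl)⟩
        · refine ⟨k, Or.inr ?_⟩
          rw [apply_zpow_mul_apply h₁ h₂, zpow_apply_zpow_apply, add_neg_cancel, h₁]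
          rfl
      trans := by
        rintro x y z ⟨k, rfl | rfl⟩ ⟨j, rfl | rfl⟩
        · exact ⟨j + k, Or.inl (zpow_apply_zpow_apply _ _ _ _)⟩
        · exact ⟨j + -k, Or.inr (by rw [apply_zpow_mul_apply h₁ h₂, zpow_apply_zpow_apply])⟩
        · exact ⟨j + k, Or.inr (zpow_apply_zpow_apply _ _ _ _)⟩
        · exact ⟨j + -k, Or.inl (by
            rw [apply_zpow_mul_apply h₁ h₂, zpow_apply_zpow_apply, h₁])⟩ }

/-- The point found will be fixed by the exchanging reflection: the middle vertex of an odd path, or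
any vertex of an orbit that splits into two cycles of the rotation, where the condition is vacuous.
-/
theorem exists_base_point (h₁ : ∀ x, τ₁ (τ₁ x) = x) (h₂ : ∀ x, τ₂ (τ₂ x) = x)
    (o₁ : ∀ a, τ₁ a = a → ∃ N : ℤ, ((τ₂ * τ₁) ^ (2 * N + 1)) a = a)
    (o₂ : ∀ a, τ₂ a = a → ∃ N : ℤ, ((τ₂ * τ₁) ^ (2 * N + 1)) a = a) (x : X) :
    ∃ i : ℤ, ∀ d : ℤ, τ₁ (((τ₂ * τ₁) ^ i) x) = ((τ₂ * τ₁) ^ d) (((τ₂ * τ₁) ^ i) x) →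
      ((τ₂ * τ₁) ^ (2 * d + 1)) (((τ₂ * τ₁) ^ i) x) = ((τ₂ * τ₁) ^ i) x := by
  by_cases hd : ∃ d : ℤ, τ₁ x = ((τ₂ * τ₁) ^ d) x
  · obtain ⟨d₀, hd₀⟩ := hd
    have hM : ∃ M : ℤ, ((τ₂ * τ₁) ^ (2 * M + 1)) x = x := by
      obtain ⟨e, he⟩ := Int.even_or_odd' d₀
      -- A reflection preserving a cycle of the rotation yields, according to the parity of `d₀`, a
      -- fixed point of `τ₁` or of `τ₂` in it, so the hypotheses make the period odd.
      have : ∃ (j : ℤ) (M : ℤ),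
          ((τ₂ * τ₁) ^ (2 * M + 1)) (((τ₂ * τ₁) ^ j) x) = ((τ₂ * τ₁) ^ j) x := by
        rcases he with he | he
        · refine ⟨e, o₁ _ ?_⟩
          rw [apply_zpow_mul_apply h₁ h₂, hd₀, zpow_apply_zpow_apply, he]
          congr 2
          ring
        · refine ⟨e + 1, o₂ _ ?_⟩
          rw [apply_eq_zpow_apply h₁, apply_zpow_mul_apply h₁ h₂, hd₀, zpow_apply_zpow_apply,
            zpow_apply_zpow_apply, he]
          congr 2
          ring
      obtain ⟨j, M, h⟩ := this
      refine ⟨M, ?_⟩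
      rw [zpow_apply_zpow_apply, zpow_apply_eq_iff] at h
      rwa [add_sub_cancel_right] at h
    obtain ⟨M, hM⟩ := hM
    -- The shift must solve `4 i ≡ 2 d₀ + 1` modulo the period, a divisor of `2 M + 1`. Since `(2 M
    -- + 1) ^ 2 = 4 (M ^ 2 + M) + 1`, the inverse of 4 is `-(M ^ 2 + M)`.
    refine ⟨-((2 * d₀ + 1) * (M ^ 2 + M)), fun d h => ?_⟩
    rw [apply_zpow_mul_apply h₁ h₂, hd₀, zpow_apply_zpow_apply, zpow_apply_zpow_apply,
      zpow_apply_eq_iff] at h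
    rw [zpow_apply_zpow_apply, zpow_apply_eq_iff, add_sub_cancel_right]
    have h3 := zpow_mul_apply_eq_self h (-2)
    have h4 := zpow_mul_apply_eq_self hM ((2 * M + 1) * (2 * d₀ + 1))
    have h5 := zpow_apply_zpow_apply (τ₂ * τ₁) (-2 * (-(-((2 * d₀ + 1) * (M ^ 2 + M))) + d₀ -
      (d + -((2 * d₀ + 1) * (M ^ 2 + M))))) ((2 * M + 1) * (2 * d₀ + 1) * (2 * M + 1)) x
    rw [h4, h3] at h5
    convert h5.symm using 3
    ring
  · refine ⟨0, fun d h => (hd ⟨d, h⟩).elim⟩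

/-- If no fixed point of `τ₁` or `τ₂` lies in an even cycle of `τ₂ τ₁`, then some involution
preserving the orbits of the group generated by `τ₁` and `τ₂` exchanges `τ₁` and `τ₂`. -/
theorem exists_swap (h₁ : ∀ x, τ₁ (τ₁ x) = x) (h₂ : ∀ x, τ₂ (τ₂ x) = x)
    (o₁ : ∀ a, τ₁ a = a → ∃ N : ℤ, ((τ₂ * τ₁) ^ (2 * N + 1)) a = a)
    (o₂ : ∀ a, τ₂ a = a → ∃ N : ℤ, ((τ₂ * τ₁) ^ (2 * N + 1)) a = a) :
    ∃ u : Equiv.Perm X, (∀ x, u (u x) = x) ∧ (∀ x, u (τ₁ x) = τ₂ (u x)) ∧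
      ∀ x, ∃ k : ℤ, u x = ((τ₂ * τ₁) ^ k) x ∨ u x = ((τ₂ * τ₁) ^ k) (τ₁ x) := by
  let S := dihedralSetoid h₁ h₂
  choose i hi using exists_base_point h₁ h₂ o₁ o₂
  let b : X → X := fun x => ((τ₂ * τ₁) ^ i (Quotient.out (Quotient.mk S x)))
    (Quotient.out (Quotient.mk S x))
  have hb : ∀ x y, S x y → b x = b y := fun x y h => by
    simp only [b, show Quotient.mk S x = Quotient.mk S y from Quotient.sound h]
  have hbx : ∀ x, S (b x) x := fun x => by
    refine S.symm (S.trans (S.symm (Quotient.mk_out (s := S) x)) ⟨_, Or.inl rfl⟩)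
  have hB : ∀ x, ∀ d : ℤ, τ₁ (b x) = ((τ₂ * τ₁) ^ d) (b x) →
      ((τ₂ * τ₁) ^ (2 * d + 1)) (b x) = b x := fun x => hi _
  -- The graph of the reflection fixing the base point `y`. The exponent `1 - k` is forced by `u (τ₁
  -- y) = τ₂ y = (τ₂ * τ₁) (τ₁ y)`.
  let Rel : X → X → X → Prop := fun y x z => ∃ k : ℤ,
    (x = ((τ₂ * τ₁) ^ k) y ∧ z = ((τ₂ * τ₁) ^ (-k)) y) ∨
    (x = ((τ₂ * τ₁) ^ k) (τ₁ y) ∧ z = ((τ₂ * τ₁) ^ (1 - k)) (τ₁ y))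
  have hex : ∀ x, ∃ z, Rel (b x) x z := fun x => by
    obtain ⟨k, h | h⟩ := hbx x
    · exact ⟨_, k, Or.inl ⟨h, rfl⟩⟩
    · exact ⟨_, k, Or.inr ⟨h, rfl⟩⟩
  -- The two clauses overlap only if `τ₁ y` is in the rotation cycle of `y`; the choice of base
  -- point makes them agree there.
  have hcross : ∀ y, (∀ d : ℤ, τ₁ y = ((τ₂ * τ₁) ^ d) y → ((τ₂ * τ₁) ^ (2 * d + 1)) y = y) →
      ∀ k j : ℤ, ((τ₂ * τ₁) ^ k) y = ((τ₂ * τ₁) ^ j) (τ₁ y) →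
      ((τ₂ * τ₁) ^ (-k)) y = ((τ₂ * τ₁) ^ (1 - j)) (τ₁ y) := by
    intro y hy k j h
    have h1 : τ₁ y = ((τ₂ * τ₁) ^ (k - j)) y := by
      have := congrArg ((τ₂ * τ₁) ^ (-j)) h
      rw [zpow_apply_zpow_apply, zpow_apply_zpow_apply, neg_add_cancel, zpow_zero] at this
      rw [show k - j = -j + k by ring, this]
      rfl
    have h2 := hy _ h1
    rw [h1, zpow_apply_zpow_apply]
    symm
    rw [zpow_apply_eq_iff]
    rw [show 1 - j + (k - j) - -k = 2 * (k - j) + 1 by ring, h2]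
  have hfun : ∀ w x z z', Rel (b w) x z → Rel (b w) x z' → z = z' := by
    rintro w x z z' ⟨k, ⟨hx, rfl⟩ | ⟨hx, rfl⟩⟩ ⟨j, ⟨hx', rfl⟩ | ⟨hx', rfl⟩⟩
    · rw [hx, zpow_apply_eq_iff] at hx'
      have := zpow_mul_apply_eq_self hx' (-1)
      rw [zpow_apply_eq_iff]
      rwa [show -k - -j = -1 * (k - j) by ring]
    · exact hcross _ (hB w) k j (hx.symm.trans hx')
    · exact (hcross _ (hB w) j k (hx'.symm.trans hx)).symm
    · rw [hx, zpow_apply_eq_iff] at hx'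
      have := zpow_mul_apply_eq_self hx' (-1)
      rw [zpow_apply_eq_iff]
      rwa [show 1 - k - (1 - j) = -1 * (k - j) by ring]
  have hsymm : ∀ y x z, Rel y x z → Rel y z x := by
    rintro y x z ⟨k, ⟨rfl, rfl⟩ | ⟨rfl, rfl⟩⟩
    · exact ⟨-k, Or.inl ⟨rfl, by rw [neg_neg]⟩⟩
    · exact ⟨1 - k, Or.inr ⟨rfl, by rw [sub_sub_cancel]⟩⟩
  have hτ : ∀ y x z, Rel y x z → Rel y (τ₁ x) (τ₂ z) := by
    rintro y x z ⟨k, ⟨rfl, rfl⟩ | ⟨rfl, rfl⟩⟩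
    · refine ⟨-k, Or.inr ⟨apply_zpow_mul_apply h₁ h₂ k y, ?_⟩⟩
      rw [apply_eq_zpow_apply h₁, apply_zpow_mul_apply h₁ h₂, zpow_apply_zpow_apply, sub_eq_add_neg]
    · refine ⟨-k, Or.inl ⟨by rw [apply_zpow_mul_apply h₁ h₂, h₁], ?_⟩⟩
      rw [apply_eq_zpow_apply h₁, apply_zpow_mul_apply h₁ h₂, zpow_apply_zpow_apply, h₁]
      congr 2
      ring
  have hS : ∀ y x z, Rel y x z → S y z := by
    rintro y x z ⟨k, ⟨-, rfl⟩ | ⟨-, rfl⟩⟩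
    · exact ⟨_, Or.inl rfl⟩
    · exact ⟨_, Or.inr rfl⟩
  choose u hu using hex
  have hbu : ∀ x, b (u x) = b x := fun x =>
    hb _ _ (S.trans (S.symm (hS _ _ _ (hu x))) (hbx x))
  have huu : Function.Involutive u := fun x => by
    have h := hu (u x)
    rw [hbu] at h
    exact hfun x (u x) _ _ h (hsymm _ _ _ (hu x))
  refine ⟨huu.toPerm u, huu, fun x => ?_, fun x => ?_⟩
  · have h := hu (τ₁ x)
    rw [hb (τ₁ x) x (S.symm ⟨0, Or.inr rfl⟩)] at h
    exact hfun x (τ₁ x) _ _ h (hτ _ _ _ (hu x))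
  · exact S.trans (S.symm (hbx x)) (hS _ _ _ (hu x))

end Dihedral

/-! ### Even paths and the dichotomy for two involutions -/

section EvenPath

variable {n : ℕ}

/-- The sign of the half turn of a path with an even number `2 m` of vertices: `P` lists the
vertices, in such a way that `τ` acts as a reflection and `σ` as the translation by `m`. -/
theorem invSign_half_turn {τ σ : Equiv.Perm (Fin n)} (hτ : ∀ x, τ (τ x) = x)
    (hσ : σ * τ = τ * σ) {m : ℕ} (hm : 0 < m) {s : ℕ} (hs : s ≤ 1) (P : ℤ → Fin n)
    (hP : ∀ k j, P k = P j ↔ (2 * m : ℤ) ∣ k - j) (hPτ : ∀ k, τ (P k) = P (s - k))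
    (hPσ : ∀ k, σ (P k) = P (k + m)) (hoff : ∀ x, (∀ k, x ≠ P k) → σ x = x) :
    invSign τ σ = (-1) ^ (m - 1 + s) := by
  classical
  -- The positions from 1 to `m - 1 + s` represent the 2-cycles of the reflection `k ↦ s - k` modulo
  -- `2 m`, and translation by `m` moves every one of them out of this set.
  let A : Finset (Fin n) := (Finset.Ioc (0 : ℤ) (m - 1 + s : ℤ)).image P
  let O : Finset (Fin n) := A ∪ Finset.univ.filter fun x => (∀ k, x ≠ P k) ∧ x < τ x
  have hmod : ∀ k : ℤ, ∃ k' : ℤ, 0 ≤ k' ∧ k' < 2 * m ∧ P k = P k' := fun k =>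
    ⟨k % (2 * m), Int.emod_nonneg _ (by omega), Int.emod_lt_of_pos _ (by omega),
      (hP _ _).mpr (Int.dvd_self_sub_emod)⟩
  have huniq : ∀ k j : ℤ, 0 ≤ k → k < 2 * m → 0 ≤ j → j < 2 * m → P k = P j → k = j := by
    intro k j hk hk' hj hj' h
    have h2 := Int.emod_eq_emod_iff_emod_sub_eq_zero.mpr
      (Int.emod_eq_zero_of_dvd ((hP k j).mp h))
    rw [Int.emod_eq_of_lt hk hk', Int.emod_eq_of_lt hj hj'] at h2
    exact h2
  have hA : ∀ k : ℤ, 0 ≤ k → k < 2 * m → (P k ∈ A ↔ 0 < k ∧ k ≤ m - 1 + s) := by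
    intro k hk hk'
    simp only [A, Finset.mem_image, Finset.mem_Ioc]
    refine ⟨?_, fun h => ⟨k, h, rfl⟩⟩
    rintro ⟨j, hj, h⟩
    have := huniq j k (by omega) (by omega) hk hk' h
    omega
  have hO : ∀ k : ℤ, 0 ≤ k → k < 2 * m → (P k ∈ O ↔ 0 < k ∧ k ≤ m - 1 + s) := by
    intro k hk hk'
    rw [← hA k hk hk']
    simp only [O, Finset.mem_union, Finset.mem_filter]
    exact ⟨fun h => h.resolve_right fun h' => h'.2.1 k rfl, Or.inl⟩
  have hOoff : ∀ x, (∀ k, x ≠ P k) → (x ∈ O ↔ x < τ x) := by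
    intro x hx
    simp only [O, A, Finset.mem_union, Finset.mem_filter, Finset.mem_image, Finset.mem_univ,
      true_and]
    refine ⟨fun h => h.elim (fun ⟨k, _, hk⟩ => (hx k hk.symm).elim) And.right,
      fun h => Or.inr ⟨hx, h⟩⟩
  have hτoff : ∀ x, (∀ k, x ≠ P k) → ∀ k, τ x ≠ P k := by
    intro x hx k h
    refine hx (s - k) ?_
    rw [← hPτ, ← h, hτ]
  have htr : IsTransversal τ O := by
    constructor
    · intro x hx
      by_cases h : ∀ k, x ≠ P k
      · rw [hOoff x h, hx]
        exact lt_irrefl x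
      · push Not at h
        obtain ⟨k, rfl⟩ := h
        obtain ⟨k', h1, h2, h3⟩ := hmod k
        rw [h3] at hx ⊢
        rw [hO k' h1 h2]
        rw [hPτ] at hx
        by_cases hk : k' ≤ s
        · have := huniq _ _ (by omega) (by omega) h1 h2 hx
          omega
        -- The reflected index is negative here and is lifted back to the range from 0 to `2 m - 1`.
        · have h4 : P (s - k') = P (s - k' + 2 * m) := (hP _ _).mpr ⟨-1, by ring⟩
          rw [h4] at hx
          have := huniq _ _ (by omega) (by omega) h1 h2 hx
          omega
    · intro x hx
      by_cases h : ∀ k, x ≠ P k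
      · rw [hOoff x h, hOoff _ (hτoff x h), hτ, not_lt]
        exact ⟨le_of_lt, fun h => lt_of_le_of_ne h (Ne.symm hx)⟩
      · push Not at h
        obtain ⟨k, rfl⟩ := h
        obtain ⟨k', h1, h2, h3⟩ := hmod k
        rw [h3] at hx ⊢
        rw [hPτ] at hx ⊢
        rw [hO k' h1 h2]
        by_cases hk : k' ≤ s
        · rw [hO _ (by omega) (by omega)]
          have h5 : (s : ℤ) - k' ≠ k' := fun h => hx (by rw [h])
          omega
        · have h4 : P (s - k') = P (s - k' + 2 * m) := (hP _ _).mpr ⟨-1, by ring⟩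
          rw [h4] at hx ⊢
          rw [hO _ (by omega) (by omega)]
          have h5 : (s : ℤ) - k' + 2 * m ≠ k' := fun h => hx (by rw [h])
          omega
  have hcond : ∀ x ∈ O, (if σ x ∈ O then (1 : ℤ) else -1) = if x ∈ A then -1 else 1 := by
    intro x hx
    by_cases h : ∀ k, x ≠ P k
    · have hxA : x ∉ A := by
        intro hxA
        obtain ⟨k, -, hk⟩ := Finset.mem_image.mp hxA
        exact h k hk.symm
      rw [hoff x h, if_pos hx, if_neg hxA]
    · push Not at h
      obtain ⟨k, rfl⟩ := h
      obtain ⟨k', h1, h2, h3⟩ := hmod k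
      rw [h3] at hx ⊢
      have h6 := (hO k' h1 h2).mp hx
      rw [if_pos ((hA k' h1 h2).mpr h6), if_neg]
      rw [hPσ]
      by_cases hk : k' + m < 2 * m
      · rw [hO _ (by omega) hk]
        omega
      · have h4 : P (k' + m) = P (k' - m) := (hP _ _).mpr ⟨1, by ring⟩
        rw [h4, hO _ (by omega) (by omega)]
        omega
  have hcard : A.card = m - 1 + s := by
    rw [Finset.card_image_of_injOn, Int.card_Ioc]
    · omega
    · intro k hk j hj h
      simp only [Finset.coe_Ioc, Set.mem_Ioc] at hk hj
      exact huniq k j (by omega) (by omega) (by omega) (by omega) h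
  rw [invSign_eq_prod_of_commute hτ hσ htr, Finset.prod_congr rfl hcond, Finset.prod_ite,
    Finset.prod_const, Finset.prod_const_one, mul_one]
  congr 1
  rw [← hcard]
  congr 1
  ext x
  simp only [O, Finset.mem_filter, Finset.mem_union]
  tauto

/-- A fixed point of `τ₁` in an even cycle of `τ₂ τ₁` yields a permutation commuting with `τ₁` and
`τ₂` on which the two signs differ. -/
theorem exists_invSign_ne {τ₁ τ₂ : Equiv.Perm (Fin n)} (h₁ : ∀ x, τ₁ (τ₁ x) = x)
    (h₂ : ∀ x, τ₂ (τ₂ x) = x) {a : Fin n} (ha : τ₁ a = a)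
    (hev : Even (Function.minimalPeriod (τ₂ * τ₁) a)) :
    ∃ σ : Equiv.Perm (Fin n), σ * τ₁ = τ₁ * σ ∧ σ * τ₂ = τ₂ * σ ∧
      (∀ x, ∃ k : ℤ, σ x = ((τ₂ * τ₁) ^ k) x) ∧ invSign τ₁ σ ≠ invSign τ₂ σ := by
  classical
  obtain ⟨m, hm⟩ := hev
  have hpos : 0 < Function.minimalPeriod (τ₂ * τ₁) a :=
    Function.minimalPeriod_pos_of_mem_periodicPts
      ((τ₂ * τ₁).injective.mem_periodicPts a)
  let P : ℤ → Fin n := fun k => ((τ₂ * τ₁) ^ k) a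
  have hP0 : ∀ k : ℤ, P k = a ↔ (2 * m : ℤ) ∣ k := by
    intro k
    have h := MulAction.zpow_smul_eq_iff_minimalPeriod_dvd (a := τ₂ * τ₁) (b := a) (n := k)
    have h' : Function.minimalPeriod ((τ₂ * τ₁) • ·) a = 2 * m := by
      rw [two_mul, ← hm]
      rfl
    rw [h'] at h
    exact_mod_cast h
  have hP : ∀ k j, P k = P j ↔ (2 * m : ℤ) ∣ k - j := by
    intro k j
    rw [← hP0]
    exact zpow_apply_eq_iff _ _ _ _
  have hadd : ∀ k j : ℤ, ((τ₂ * τ₁) ^ k) (P j) = P (k + j) := fun k j =>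
    zpow_apply_zpow_apply _ _ _ _
  have hPτ₁ : ∀ k, τ₁ (P k) = P (-k) := fun k => by
    simp only [P]
    rw [apply_zpow_mul_apply h₁ h₂, ha]
  have hPτ₂ : ∀ k, τ₂ (P k) = P (1 - k) := fun k => by
    rw [apply_eq_zpow_apply h₁, hPτ₁, hadd, sub_eq_add_neg]
  -- The half turn of the cycle through `a`, which reverses the underlying path, extended by the
  -- identity.
  let f : Fin n → Fin n := fun x => if ∃ k, x = P k then ((τ₂ * τ₁) ^ (m : ℤ)) x else x
  have hfP : ∀ k, f (P k) = P (k + m) := fun k => by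
    simp only [f]
    rw [if_pos ⟨k, rfl⟩, hadd, add_comm]
  have hfoff : ∀ x, (∀ k, x ≠ P k) → f x = x := fun x hx => by
    simp only [f]
    rw [if_neg]
    push Not
    exact hx
  have hff : Function.Involutive f := by
    intro x
    by_cases h : ∀ k, x ≠ P k
    · rw [hfoff x h, hfoff x h]
    · push Not at h
      obtain ⟨k, rfl⟩ := h
      rw [hfP, hfP, hP]
      exact ⟨1, by ring⟩
  have hc₁ : ∀ x, f (τ₁ x) = τ₁ (f x) := by
    intro x
    by_cases h : ∀ k, x ≠ P k
    · rw [hfoff x h, hfoff]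
      intro k hk
      exact h (-k) (by rw [← hPτ₁, ← hk, h₁])
    · push Not at h
      obtain ⟨k, rfl⟩ := h
      rw [hfP, hPτ₁, hPτ₁, hfP, hP]
      exact ⟨1, by ring⟩
  have hc₂ : ∀ x, f (τ₂ x) = τ₂ (f x) := by
    intro x
    by_cases h : ∀ k, x ≠ P k
    · rw [hfoff x h, hfoff]
      intro k hk
      exact h (1 - k) (by rw [← hPτ₂, ← hk, h₂])
    · push Not at h
      obtain ⟨k, rfl⟩ := h
      rw [hfP, hPτ₂, hPτ₂, hfP, hP]
      exact ⟨1, by ring⟩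
  have e₁ : hff.toPerm f * τ₁ = τ₁ * hff.toPerm f := Equiv.ext hc₁
  have e₂ : hff.toPerm f * τ₂ = τ₂ * hff.toPerm f := Equiv.ext hc₂
  refine ⟨hff.toPerm f, e₁, e₂, fun x => ?_, ?_⟩
  · by_cases h : ∃ k, x = P k
    · exact ⟨m, if_pos h⟩
    · exact ⟨0, if_neg h⟩
  -- Here `τ₁` is the reflection with `s = 0` and `τ₂` the one with `s = 1`, so the exponents are `m
  -- - 1` and `m`.
  · rw [invSign_half_turn h₁ e₁ (by omega) zero_le_one P hP (by simpa using hPτ₁) hfP hfoff,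
      invSign_half_turn h₂ e₂ (by omega) le_rfl P hP (by simpa using hPτ₂) hfP hfoff, add_zero,
      pow_succ, mul_neg_one]
    intro h
    have := pow_ne_zero (m - 1) (show (-1 : ℤ) ≠ 0 by norm_num)
    omega

/-- Two involutions are either exchanged by an involution, or commute with a permutation on which
their signs differ; in both cases the orbits are preserved. -/
theorem exists_swap_or_invSign_ne {α : Type*} {τ₁ τ₂ : Equiv.Perm (Fin n)}
    (h₁ : ∀ x, τ₁ (τ₁ x) = x) (h₂ : ∀ x, τ₂ (τ₂ x) = x) (c : Fin n → α)
    (c₁ : ∀ x, c (τ₁ x) = c x) (c₂ : ∀ x, c (τ₂ x) = c x) :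
    (∃ u : Equiv.Perm (Fin n), (∀ x, u (u x) = x) ∧ (∀ x, u (τ₁ x) = τ₂ (u x)) ∧
      ∀ x, c (u x) = c x) ∨
    (∃ σ : Equiv.Perm (Fin n), σ * τ₁ = τ₁ * σ ∧ σ * τ₂ = τ₂ * σ ∧ (∀ x, c (σ x) = c x) ∧
      invSign τ₁ σ ≠ invSign τ₂ σ) := by
  have hc : ∀ {ρ₁ ρ₂ : Equiv.Perm (Fin n)}, (∀ x, c (ρ₁ x) = c x) → (∀ x, c (ρ₂ x) = c x) →
      ∀ (k : ℤ) x, c (((ρ₂ * ρ₁) ^ k) x) = c x := by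
    intro ρ₁ ρ₂ hρ₁ hρ₂ k
    have h : ∀ x, c ((ρ₂ * ρ₁) x) = c x := fun x => by rw [Equiv.Perm.mul_apply, hρ₂, hρ₁]
    induction k using Int.induction_on with
    | zero => intro x; rfl
    | succ k ih => intro x; rw [zpow_add_one, Equiv.Perm.mul_apply, ih, h]
    | pred k ih =>
      intro x
      rw [zpow_sub_one, Equiv.Perm.mul_apply, ih, ← h ((ρ₂ * ρ₁)⁻¹ x)]
      exact congrArg c ((ρ₂ * ρ₁).apply_symm_apply x)
  by_cases b₁ : ∃ a, τ₁ a = a ∧ Even (Function.minimalPeriod (τ₂ * τ₁) a)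
  · obtain ⟨a, ha, hev⟩ := b₁
    obtain ⟨σ, s₁, s₂, s₃, s₄⟩ := exists_invSign_ne h₁ h₂ ha hev
    refine Or.inr ⟨σ, s₁, s₂, fun x => ?_, s₄⟩
    obtain ⟨k, hk⟩ := s₃ x
    rw [hk, hc c₁ c₂]
  by_cases b₂ : ∃ a, τ₂ a = a ∧ Even (Function.minimalPeriod (τ₁ * τ₂) a)
  · obtain ⟨a, ha, hev⟩ := b₂
    obtain ⟨σ, s₂, s₁, s₃, s₄⟩ := exists_invSign_ne h₂ h₁ ha hev
    refine Or.inr ⟨σ, s₁, s₂, fun x => ?_, s₄.symm⟩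
    obtain ⟨k, hk⟩ := s₃ x
    rw [hk, hc c₂ c₁]
  push Not at b₁ b₂
  have odd_period : ∀ (p : Equiv.Perm (Fin n)) a, ¬ Even (Function.minimalPeriod p a) →
      ∃ N : ℤ, (p ^ (2 * N + 1)) a = a := by
    intro p a h
    obtain ⟨N, hN⟩ := Nat.not_even_iff_odd.mp h
    refine ⟨N, ?_⟩
    have h1 := Function.isPeriodicPt_minimalPeriod p a
    rw [hN] at h1
    have h2 : (p ^ (2 * N + 1)) a = a := by
      rw [← Equiv.Perm.iterate_eq_pow]
      exact h1
    exact_mod_cast h2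
  obtain ⟨u, u₁, u₂, u₃⟩ := exists_swap h₁ h₂ (fun a ha => odd_period _ a (b₁ a ha))
    (fun a ha => by
      obtain ⟨N, hN⟩ := odd_period _ a (b₂ a ha)
      -- The hypothesis concerns `τ₁ * τ₂`, the inverse rotation, so the same odd exponent serves.
      have h := congrArg ((τ₂ * τ₁) ^ (2 * N + 1)) hN
      have hinv : (τ₂ * τ₁) * (τ₁ * τ₂) = 1 := Equiv.ext fun x => by
        simp [Equiv.Perm.mul_apply, h₁, h₂]
      rw [← inv_eq_of_mul_eq_one_right hinv, inv_zpow', zpow_apply_zpow_apply, add_neg_cancel] at h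
      exact ⟨N, h.symm⟩)
  refine Or.inl ⟨u, u₁, u₂, fun x => ?_⟩
  obtain ⟨k, hk | hk⟩ := u₃ x
  · rw [hk, hc c₁ c₂]
  · rw [hk, hc c₁ c₂, c₁]

end EvenPath

/-! ### Colored permutations and the representation -/

section ColoredPermutations

variable {r n : ℕ} [NeZero r]

theorem zeta_isPrimitiveRoot (r : ℕ) [NeZero r] : IsPrimitiveRoot (zeta r) r :=
  Complex.isPrimitiveRoot_exp r (NeZero.ne r)

theorem zeta_pow_val_add (a b : ZMod r) :
    zeta r ^ (a + b).val = zeta r ^ a.val * zeta r ^ b.val := by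
  have h := pow_mod_orderOf (zeta r) (a.val + b.val)
  rwa [← (zeta_isPrimitiveRoot r).eq_orderOf, ← ZMod.val_add, pow_add] at h

theorem zeta_pow_val_injective {a b : ZMod r} (h : zeta r ^ a.val = zeta r ^ b.val) : a = b :=
  ZMod.val_injective r ((zeta_isPrimitiveRoot r).pow_inj (ZMod.val_lt a) (ZMod.val_lt b) h)

theorem zeta_pow_ne_zero (k : ℕ) : zeta r ^ k ≠ 0 :=
  pow_ne_zero _ ((zeta_isPrimitiveRoot r).ne_zero (NeZero.ne r))

theorem mat_perm_apply (g : G r n) (i : Fin n) : mat g (perm g i) i = zeta r ^ (color g i).val :=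
  (exists_color g i).choose_spec

omit [NeZero r] in
theorem eq_perm_of_mat_ne_zero {g : G r n} {i j : Fin n} (h : mat g j i ≠ 0) : j = perm g i :=
  ((mat_isMonomial g).col i).unique h (permFun_spec g i)

theorem perm_eq_and_color_eq {g : G r n} {i j : Fin n} {k : ZMod r}
    (h : mat g j i = zeta r ^ k.val) : perm g i = j ∧ color g i = k := by
  have hj : j = perm g i := eq_perm_of_mat_ne_zero (by rw [h]; exact zeta_pow_ne_zero _)
  refine ⟨hj.symm, zeta_pow_val_injective ?_⟩
  rw [← mat_perm_apply, ← hj, h]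

theorem ext_of_perm_of_color {g h : G r n} (hp : ∀ i, perm g i = perm h i)
    (hc : ∀ i, color g i = color h i) : g = h := by
  apply mat_injective
  ext j i
  by_cases hj : j = perm g i
  · rw [hj, mat_perm_apply, hc, hp, mat_perm_apply]
  · have h1 : mat g j i = 0 := by
      by_contra h
      exact hj (eq_perm_of_mat_ne_zero h)
    have h2 : mat h j i = 0 := by
      by_contra h
      exact hj ((eq_perm_of_mat_ne_zero h).trans (hp i).symm)
    rw [h1, h2]

theorem perm_mul_apply_and_color_mul (g h : G r n) (i : Fin n) :
    perm (g * h) i = perm g (perm h i) ∧ color (g * h) i = color h i + color g (perm h i) := by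
  apply perm_eq_and_color_eq
  rw [mat_mul, Matrix.mul_apply, Finset.sum_eq_single (perm h i)]
  · rw [mat_perm_apply, mat_perm_apply, zeta_pow_val_add, mul_comm]
  · intro j _ hj
    have : mat h j i = 0 := by
      by_contra h'
      exact hj (eq_perm_of_mat_ne_zero h')
    rw [this, mul_zero]
  · simp

theorem perm_mul (g h : G r n) : perm (g * h) = perm g * perm h :=
  Equiv.ext fun i => (perm_mul_apply_and_color_mul g h i).1

theorem color_mul (g h : G r n) (i : Fin n) :
    color (g * h) i = color h i + color g (perm h i) := (perm_mul_apply_and_color_mul g h i).2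

/-- The permutation `|g|`, as a group homomorphism. -/
def permHom (r n : ℕ) [NeZero r] : G r n →* Equiv.Perm (Fin n) := MonoidHom.mk' perm perm_mul

theorem perm_one : perm (1 : G r n) = 1 := (permHom r n).map_one

theorem perm_inv (g : G r n) : perm g⁻¹ = (perm g)⁻¹ := (permHom r n).map_inv g

theorem perm_pow (g : G r n) (k : ℕ) : perm (g ^ k) = perm g ^ k := (permHom r n).map_pow g k

theorem perm_zpow (g : G r n) (k : ℤ) : perm (g ^ k) = perm g ^ k := (permHom r n).map_zpow g k

theorem color_one (i : Fin n) : color (1 : G r n) i = 0 := by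
  have h := color_mul (1 : G r n) 1 i
  rw [one_mul, perm_one, Equiv.Perm.one_apply] at h
  exact left_eq_add.mp h

/-- The colored permutation with given permutation and colors. -/
def colored (σ : Equiv.Perm (Fin n)) (z : Fin n → ZMod r) : G r n :=
  ofMat (Matrix.of fun i j => if i = σ j then zeta r ^ (z j).val else 0)
    { root := fun i j h => by
        simp only [Matrix.of_apply] at h ⊢
        split_ifs at h ⊢
        · rw [← pow_mul, mul_comm, pow_mul, (zeta_isPrimitiveRoot r).pow_eq_one, one_pow]
        · exact (h rfl).elim
      row := fun i => ⟨σ⁻¹ i, by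
        have : σ (σ⁻¹ i) = i := σ.apply_symm_apply i
        simp only [Matrix.of_apply, this, if_true]
        exact zeta_pow_ne_zero _, fun j h => by
          simp only [Matrix.of_apply, ne_eq, ite_eq_right_iff, not_forall] at h
          obtain ⟨rfl, -⟩ := h
          exact (σ.symm_apply_apply j).symm⟩
      col := fun j => ⟨σ j, by
        simp only [Matrix.of_apply, if_true]
        exact zeta_pow_ne_zero _, fun i h => by
          simp only [Matrix.of_apply, ne_eq, ite_eq_right_iff, not_forall] at h
          exact h.1⟩ }

theorem perm_colored_apply_and_color_colored (σ : Equiv.Perm (Fin n)) (z : Fin n → ZMod r)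
    (i : Fin n) : perm (colored σ z) i = σ i ∧ color (colored σ z) i = z i :=
  perm_eq_and_color_eq (if_pos rfl)

theorem perm_colored (σ : Equiv.Perm (Fin n)) (z : Fin n → ZMod r) : perm (colored σ z) = σ :=
  Equiv.ext fun i => (perm_colored_apply_and_color_colored σ z i).1

theorem color_colored (σ : Equiv.Perm (Fin n)) (z : Fin n → ZMod r) (i : Fin n) :
    color (colored σ z) i = z i := (perm_colored_apply_and_color_colored σ z i).2

theorem perm_absMat_apply_and_color_absMat (g : G r n) (i : Fin n) :
    perm (absMat g) i = perm g i ∧ color (absMat g) i = 0 := by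
  apply perm_eq_and_color_eq
  change ((‖mat g (perm g i) i‖ : ℝ) : ℂ) = _
  rw [mat_perm_apply, norm_pow, (zeta_isPrimitiveRoot r).norm'_eq_one (NeZero.ne r)]
  simp

theorem perm_absMat (g : G r n) : perm (absMat g) = perm g :=
  Equiv.ext fun i => (perm_absMat_apply_and_color_absMat g i).1

theorem color_absMat (g : G r n) (i : Fin n) : color (absMat g) i = 0 :=
  (perm_absMat_apply_and_color_absMat g i).2

instance : Finite (G r n) :=
  Finite.of_injective (fun g : G r n => (perm g, color g)) fun g h hgh =>
    ext_of_perm_of_color (fun i => by rw [show perm g = perm h from congrArg Prod.fst hgh])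
      (fun i => by rw [show color g = color h from congrArg Prod.snd hgh])

/-- Nonzero entries have modulus one, so conjugation inverts them, while the inverse matrix is the
transpose of the entrywise inverses. Thus `bar v = v⁻¹` says that `v` equals its transpose. -/
theorem mem_absInvolutions_iff_isSymm (v : G r n) :
    v ∈ absInvolutions r n ↔ (mat v).IsSymm := by
  have hconj : ∀ i j, (starRingEnd ℂ) (mat v i j) = (mat v i j)⁻¹ := by
    intro i j
    by_cases h : mat v i j = 0
    · rw [h, map_zero, inv_zero]
    · rw [Complex.inv_eq_conj (Complex.norm_eq_one_of_pow_eq_one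
        ((mat_isMonomial v).root i j h) (NeZero.ne r))]
  have h1 : v ∈ absInvolutions r n ↔ bar v = v⁻¹ := by
    change v * bar v = 1 ↔ _
    rw [mul_eq_one_iff_inv_eq, eq_comm]
  have h2 : mat v⁻¹ = invT (mat v) := (mat_isMonomial v).coe_inv
  rw [h1, ← mat_injective.eq_iff, h2, Matrix.IsSymm, ← Matrix.ext_iff, ← Matrix.ext_iff]
  refine forall₂_congr fun i j => ?_
  change (starRingEnd ℂ) (mat v i j) = (mat v j i)⁻¹ ↔ mat v j i = mat v i j
  rw [hconj, inv_inj, eq_comm]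

theorem perm_perm_and_color_perm (v : absInvolutions r n) (i : Fin n) :
    perm v.1 (perm v.1 i) = i ∧ color v.1 (perm v.1 i) = color v.1 i := by
  apply perm_eq_and_color_eq
  rw [← mat_perm_apply]
  exact ((mem_absInvolutions_iff_isSymm v.1).mp v.2).apply _ _

theorem perm_perm (v : absInvolutions r n) (i : Fin n) : perm v.1 (perm v.1 i) = i :=
  (perm_perm_and_color_perm v i).1

theorem color_perm (v : absInvolutions r n) (i : Fin n) :
    color v.1 (perm v.1 i) = color v.1 i := (perm_perm_and_color_perm v i).2

/-- The absolute involution with given permutation and colors. -/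
def coloredInvolution (τ : Equiv.Perm (Fin n)) (c : Fin n → ZMod r) (hτ : ∀ i, τ (τ i) = i)
    (hc : ∀ i, c (τ i) = c i) : absInvolutions r n :=
  ⟨colored τ c, by
    rw [mem_absInvolutions_iff_isSymm]
    ext i j
    change (if j = τ i then zeta r ^ (c i).val else 0) = if i = τ j then zeta r ^ (c j).val else 0
    by_cases h : j = τ i
    · rw [if_pos h, if_pos (by rw [h, hτ]), h, hc]
    · rw [if_neg h, if_neg]
      rintro rfl
      exact h (hτ j).symm⟩

theorem perm_absConj (g : G r n) (v : absInvolutions r n) :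
    perm (absConj g v).1 = perm g * perm v.1 * (perm g)⁻¹ := by
  change perm (absMat g * v.1 * (absMat g)⁻¹) = _
  rw [perm_mul, perm_mul, perm_inv, perm_absMat]

theorem color_absConj (g : G r n) (v : absInvolutions r n) (i : Fin n) :
    color (absConj g v).1 (perm g i) = color v.1 i := by
  have h : absMat g * v.1 = (absConj g v).1 * absMat g := by
    change _ = absMat g * v.1 * (absMat g)⁻¹ * absMat g
    group
  have h2 := congrArg (fun x => color x i) h
  simp only [color_mul, color_absMat, perm_absMat, zero_add, add_zero] at h2
  exact h2.symm

theorem absConj_eq_iff (g : G r n) (v w : absInvolutions r n) :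
    absConj g v = w ↔ (∀ i, perm g (perm v.1 i) = perm w.1 (perm g i)) ∧
      ∀ i, color v.1 i = color w.1 (perm g i) := by
  constructor
  · rintro rfl
    refine ⟨fun i => ?_, fun i => (color_absConj g v i).symm⟩
    rw [perm_absConj]
    simp [Equiv.Perm.mul_apply]
  · rintro ⟨h1, h2⟩
    apply Subtype.ext
    refine ext_of_perm_of_color (fun i => ?_) fun i => ?_
    · obtain ⟨i, rfl⟩ := (perm g).surjective i
      rw [← h1, perm_absConj]
      simp [Equiv.Perm.mul_apply]
    · obtain ⟨i, rfl⟩ := (perm g).surjective i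
      rw [← h2, color_absConj]

theorem absConj_one (v : absInvolutions r n) : absConj 1 v = v := by
  rw [absConj_eq_iff, perm_one]
  exact ⟨fun _ => rfl, fun _ => rfl⟩

theorem absConj_mul (g h : G r n) (v : absInvolutions r n) :
    absConj (g * h) v = absConj g (absConj h v) := by
  have h1 := (absConj_eq_iff h v _).mp rfl
  have h2 := (absConj_eq_iff g (absConj h v) _).mp rfl
  rw [absConj_eq_iff, perm_mul]
  refine ⟨fun i => ?_, fun i => ?_⟩
  · rw [Equiv.Perm.mul_apply, Equiv.Perm.mul_apply, h1.1, h2.1]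
  · rw [Equiv.Perm.mul_apply, h1.2, h2.2]

theorem absConj_inv_eq_iff (g : G r n) (v w : absInvolutions r n) :
    absConj g⁻¹ v = w ↔ absConj g w = v := by
  constructor
  · rintro rfl
    rw [← absConj_mul, mul_inv_cancel, absConj_one]
  · rintro rfl
    rw [← absConj_mul, inv_mul_cancel, absConj_one]

theorem absConj_injective (g : G r n) : Function.Injective (absConj (r := r) (n := n) g) :=
  fun v w h => ((absConj_inv_eq_iff g _ v).mpr rfl).symm.trans
    ((absConj_inv_eq_iff g _ w).mpr h.symm)

/-- The coefficient by which `g` acts on the basis vector indexed by `v`. -/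
def coefficient (g : G r n) (v : absInvolutions r n) : ℂ :=
  zeta r ^ (pairing g v).val * (-1) ^ invPerm (perm v.1) (perm g)

theorem coefficient_eq (g : G r n) (v : absInvolutions r n) :
    coefficient g v = zeta r ^ (pairing g v).val * (invSign (perm v.1) (perm g) : ℂ) := by
  rw [coefficient, invSign]
  push_cast
  rfl

theorem pairing_mul (g h : G r n) (v : absInvolutions r n) :
    pairing (g * h) v.1 = pairing g (absConj h v).1 + pairing h v.1 := by
  unfold pairing
  rw [← Equiv.sum_comp (perm h) (fun i => color g i * color (absConj h v).1 i),
    ← Finset.sum_add_distrib]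
  refine Finset.sum_congr rfl fun i _ => ?_
  rw [color_mul, color_absConj]
  ring

/-- The pairing is an additive cocycle and the inversion sign a multiplicative one; this is why the
formula defines a representation. -/
theorem coefficient_mul (g h : G r n) (v : absInvolutions r n) :
    coefficient (g * h) v = coefficient g (absConj h v) * coefficient h v := by
  rw [coefficient_eq, coefficient_eq, coefficient_eq, pairing_mul, zeta_pow_val_add, perm_mul,
    invSign_mul (perm_perm v), perm_absConj]
  push_cast
  ring

theorem coefficient_one (v : absInvolutions r n) : coefficient 1 v = 1 := by
  rw [coefficient_eq, perm_one, invSign_one]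
  simp [pairing, color_one]

theorem coefficient_ne_zero (g : G r n) (v : absInvolutions r n) : coefficient g v ≠ 0 :=
  mul_ne_zero (zeta_pow_ne_zero _) (pow_ne_zero _ (neg_ne_zero.mpr one_ne_zero))

/-- The representation of `G(r,n)` on the space with basis the absolute involutions. -/
def modelRep (r n : ℕ) [NeZero r] : Representation ℂ (G r n) (absInvolutions r n →₀ ℂ) where
  toFun g := Finsupp.linearCombination ℂ fun v => coefficient g v • Finsupp.single (absConj g v) 1
  map_one' := by
    ext v w
    simp [coefficient_one, absConj_one]
  map_mul' g h := by
    ext v w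
    simp [coefficient_mul, absConj_mul]
    ring

theorem modelRep_single (g : G r n) (v : absInvolutions r n) (a : ℂ) :
    modelRep r n g (Finsupp.single v a) = Finsupp.single (absConj g v) (a * coefficient g v) := by
  change Finsupp.linearCombination ℂ _ _ = _
  rw [Finsupp.linearCombination_single, Finsupp.smul_single, Finsupp.smul_single]
  simp

theorem modelRep_apply_absConj (g : G r n) (x : absInvolutions r n →₀ ℂ)
    (w : absInvolutions r n) : modelRep r n g x (absConj g w) = coefficient g w * x w := by
  induction x using Finsupp.induction_linear with
  | zero => simp
  | add x y hx hy => rw [map_add, Finsupp.add_apply, Finsupp.add_apply, hx, hy, mul_add]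
  | single v a =>
    rw [modelRep_single]
    by_cases h : v = w
    · rw [h, Finsupp.single_eq_same, Finsupp.single_eq_same, mul_comm]
    · rw [Finsupp.single_eq_of_ne' h,
        Finsupp.single_eq_of_ne' fun h' => h (absConj_injective g h'), mul_zero]

end ColoredPermutations

/-! ### Symmetry of intertwiners and averaged elementary maps -/

section Commutant

variable {r n : ℕ} [NeZero r]

open Representation (IntertwiningMap)

/-- Compare the coefficients at `absConj g w` after moving `g` through `f`. -/
theorem intertwining_apply_absConj (f : IntertwiningMap (modelRep r n) (modelRep r n))
    (g : G r n) (v w : absInvolutions r n) :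
    coefficient g v * f (Finsupp.single (absConj g v) 1) (absConj g w) =
      coefficient g w * f (Finsupp.single v 1) w := by
  have h := f.isIntertwining _ _ g (Finsupp.single v 1)
  rw [modelRep_single, mul_comm, ← smul_eq_mul, ← Finsupp.smul_single, map_smul] at h
  have h2 := congrArg (fun x => x (absConj g w)) h
  simp only [Finsupp.smul_apply, smul_eq_mul, modelRep_apply_absConj] at h2
  exact h2

theorem intertwining_apply_eq_zero (f : IntertwiningMap (modelRep r n) (modelRep r n))
    {g : G r n} {v w : absInvolutions r n} (hv : absConj g v = v) (hw : absConj g w = w)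
    (hne : coefficient g v ≠ coefficient g w) : f (Finsupp.single v 1) w = 0 := by
  have h := intertwining_apply_absConj f g v w
  rw [hv, hw, ← sub_eq_zero, ← sub_mul] at h
  exact (mul_eq_zero.mp h).resolve_left (sub_ne_zero.mpr hne)

theorem coefficient_colored_zero (σ : Equiv.Perm (Fin n)) (v : absInvolutions r n) :
    coefficient (colored σ 0) v = invSign (perm v.1) σ := by
  rw [coefficient_eq, perm_colored]
  simp [pairing, color_colored]

theorem intertwining_symm (f : IntertwiningMap (modelRep r n) (modelRep r n))
    (v w : absInvolutions r n) : f (Finsupp.single v 1) w = f (Finsupp.single w 1) v := by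
  classical
  suffices h : (∃ g : G r n, absConj g v = v ∧ absConj g w = w ∧
      coefficient g v ≠ coefficient g w) ∨
      ∃ g : G r n, absConj g v = w ∧ absConj g w = v ∧ coefficient g v = coefficient g w by
    rcases h with ⟨g, hv, hw, hne⟩ | ⟨g, hv, hw, he⟩
    · rw [intertwining_apply_eq_zero f hv hw hne, intertwining_apply_eq_zero f hw hv hne.symm]
    · have h := intertwining_apply_absConj f g v w
      rw [hv, hw, he] at h
      exact (mul_left_cancel₀ (coefficient_ne_zero g w) h).symm
  by_cases hc : color v.1 = color w.1
  · have hcw : ∀ i, color v.1 (perm w.1 i) = color v.1 i := fun i => by rw [hc, color_perm]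
    rcases exists_swap_or_invSign_ne (perm_perm v) (perm_perm w) (color v.1) (color_perm v) hcw with
      ⟨u, u₁, u₂, u₃⟩ | ⟨σ, s₁, s₂, s₃, s₄⟩
    · have hv : absConj (colored u 0) v = w := by
        rw [absConj_eq_iff, perm_colored]
        exact ⟨u₂, fun i => by rw [← hc, u₃]⟩
      have hw : absConj (colored u 0) w = v := by
        rw [absConj_eq_iff, perm_colored]
        refine ⟨fun i => ?_, fun i => by rw [← hc, u₃]⟩
        have := u₂ (u i)
        rw [u₁] at this
        rw [← this, u₁]
      refine Or.inr ⟨colored u 0, hv, hw, ?_⟩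
      have hmul : (colored u 0 : G r n) * colored u 0 = 1 := by
        refine ext_of_perm_of_color (fun i => ?_) fun i => ?_
        · rw [perm_mul, perm_colored, perm_one, Equiv.Perm.mul_apply, u₁, Equiv.Perm.one_apply]
        · rw [color_mul, color_colored, color_colored, color_one, Pi.zero_apply, Pi.zero_apply,
            add_zero]
      -- Since the element squares to 1, its coefficients at `v` and `w` multiply to 1; each is a
      -- sign, so they agree.
      have h1 := coefficient_mul (colored u 0) (colored u 0) v
      rw [hmul, coefficient_one, hv] at h1
      have h2 : coefficient (colored u 0) w * coefficient (colored u 0) w = 1 := by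
        rw [coefficient_colored_zero]
        exact_mod_cast invSign_mul_self _ _
      exact (mul_left_cancel₀ (coefficient_ne_zero _ _) (h2.trans h1)).symm
    · refine Or.inl ⟨colored σ 0, ?_, ?_, ?_⟩
      · rw [absConj_eq_iff, perm_colored]
        exact ⟨fun i => congrArg (fun p : Equiv.Perm (Fin n) => p i) s₁, fun i => (s₃ i).symm⟩
      · rw [absConj_eq_iff, perm_colored, ← hc]
        exact ⟨fun i => congrArg (fun p : Equiv.Perm (Fin n) => p i) s₂, fun i => (s₃ i).symm⟩
      · rw [coefficient_colored_zero, coefficient_colored_zero]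
        exact_mod_cast s₄
  -- At a place `i` where the colors differ, the diagonal matrix with `zeta r` at `i` fixes every
  -- basis vector up to the scalar given by its color at `i`.
  · obtain ⟨i, hi⟩ := Function.ne_iff.mp hc
    have hstab : ∀ v : absInvolutions r n,
        absConj (colored 1 (Pi.single i 1)) v = v := fun v => by
      rw [absConj_eq_iff, perm_colored]
      exact ⟨fun _ => rfl, fun _ => rfl⟩
    have hcoef : ∀ v : absInvolutions r n,
        coefficient (colored 1 (Pi.single i 1)) v = zeta r ^ (color v.1 i).val := fun v => by
      rw [coefficient_eq, perm_colored, invSign_one]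
      simp [pairing, color_colored, Pi.single_apply]
    refine Or.inl ⟨colored 1 (Pi.single i 1), hstab v, hstab w, ?_⟩
    rw [hcoef, hcoef]
    exact fun h => hi (zeta_pow_val_injective h)

theorem intertwining_mul_apply (f f' : IntertwiningMap (modelRep r n) (modelRep r n))
    [Fintype (absInvolutions r n)] (v w : absInvolutions r n) :
    (f * f') (Finsupp.single v 1) w =
      ∑ u, f' (Finsupp.single v 1) u * f (Finsupp.single u 1) w := by
  change f (f' (Finsupp.single v 1)) w = _
  have h : ∀ x : absInvolutions r n →₀ ℂ, f x w = ∑ u, x u * f (Finsupp.single u 1) w := by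
    intro x
    conv_lhs => rw [← Finsupp.univ_sum_single x, map_sum, Finsupp.finsetSum_apply]
    refine Finset.sum_congr rfl fun u _ => ?_
    rw [← mul_one (x u), ← smul_eq_mul, ← Finsupp.smul_single, map_smul, Finsupp.smul_apply,
      smul_eq_mul, smul_eq_mul, mul_one]
  exact h _

/-- A product of intertwiners is an intertwiner, hence also symmetric; transposing it exchanges the
factors. -/
theorem intertwining_commute (f f' : IntertwiningMap (modelRep r n) (modelRep r n)) :
    f * f' = f' * f := by
  have := Fintype.ofFinite (absInvolutions r n)
  ext v w
  change (f * f') (Finsupp.single v 1) w = (f' * f) (Finsupp.single v 1) w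
  rw [intertwining_symm (f' * f), intertwining_mul_apply, intertwining_mul_apply]
  refine Finset.sum_congr rfl fun u _ => ?_
  rw [intertwining_symm f' v u, intertwining_symm f u w, mul_comm]

/-- The average of the elementary map `C_v ↦ C_w`. -/
def averagedMap (v w : absInvolutions r n) [Fintype (G r n)] :
    IntertwiningMap (modelRep r n) (modelRep r n) where
  toLinearMap := ∑ g : G r n, modelRep r n g ∘ₗ (Finsupp.lsingle w ∘ₗ Finsupp.lapply v) ∘ₗ
    modelRep r n g⁻¹
  isIntertwining' h := by
    simp only [← Module.End.mul_eq_comp]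
    rw [Finset.sum_mul, Finset.mul_sum, ← Equiv.sum_comp (Equiv.mulLeft h)]
    refine Finset.sum_congr rfl fun g _ => ?_
    simp only [Equiv.coe_mulLeft, mul_inv_rev, map_mul, mul_assoc]
    rw [← map_mul, inv_mul_cancel, map_one, mul_one]

theorem averagedMap_apply [DecidableEq (absInvolutions r n)] (v w x y : absInvolutions r n)
    [Fintype (G r n)] :
    averagedMap v w (Finsupp.single x 1) y = ∑ g : G r n,
      if absConj g v = x ∧ absConj g w = y then coefficient g⁻¹ x * coefficient g w else 0 := by
  change (∑ g : G r n, modelRep r n g ∘ₗ (Finsupp.lsingle w ∘ₗ Finsupp.lapply v) ∘ₗ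
    modelRep r n g⁻¹) (Finsupp.single x 1) y = _
  rw [LinearMap.sum_apply, Finsupp.finsetSum_apply]
  refine Finset.sum_congr rfl fun g _ => ?_
  simp only [LinearMap.comp_apply, modelRep_single, Finsupp.lapply_apply, Finsupp.lsingle_apply,
    one_mul, Finsupp.single_apply, absConj_inv_eq_iff]
  by_cases h1 : absConj g v = x <;> by_cases h2 : absConj g w = y <;> simp [h1, h2]

/-- Every common stabilizing element acts on both basis vectors by the same coefficient. -/
def IsAdmissible (v w : absInvolutions r n) : Prop :=
  ∀ g : G r n, absConj g v = v → absConj g w = w → coefficient g v = coefficient g w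

/-- On admissible pairs every term from the common stabilizer equals 1, so the entry is the order of
that stabilizer. -/
theorem averagedMap_apply_self_ne_zero {v w : absInvolutions r n} [Fintype (G r n)]
    (h : IsAdmissible v w) : averagedMap v w (Finsupp.single v 1) w ≠ 0 := by
  classical
  rw [averagedMap_apply]
  have h1 : ∀ g : G r n, (if absConj g v = v ∧ absConj g w = w then
      coefficient g⁻¹ v * coefficient g w else 0) =
      if absConj g v = v ∧ absConj g w = w then 1 else 0 := by
    intro g
    by_cases hg : absConj g v = v ∧ absConj g w = w
    · rw [if_pos hg, if_pos hg, ← h g hg.1 hg.2]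
      have h2 := coefficient_mul g⁻¹ g v
      rw [hg.1, inv_mul_cancel, coefficient_one] at h2
      exact h2.symm
    · rw [if_neg hg, if_neg hg]
  rw [Finset.sum_congr rfl fun g _ => h1 g, Finset.sum_boole, Nat.cast_ne_zero,
    ← Nat.pos_iff_ne_zero, Finset.card_pos]
  exact ⟨1, by simp [absConj_one]⟩

/-- The entries of an averaged map are supported on the orbit of its pair, and distinct indices have
disjoint orbits. -/
theorem linearIndependent_averagedMap {ι : Type*} [Fintype (G r n)]
    (v w : ι → absInvolutions r n) (h : ∀ i, IsAdmissible (v i) (w i))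
    (hne : ∀ i j (g : G r n), absConj g (v i) = v j → absConj g (w i) = w j → i = j) :
    LinearIndependent ℂ fun i => averagedMap (v i) (w i) := by
  classical
  let L : IntertwiningMap (modelRep r n) (modelRep r n) →ₗ[ℂ]
      (absInvolutions r n × absInvolutions r n → ℂ) :=
    { toFun := fun f p => f (Finsupp.single p.1 1) p.2
      map_add' := fun _ _ => rfl
      map_smul' := fun _ _ => rfl }
  refine LinearIndependent.of_comp L ?_
  rw [linearIndependent_iff']
  intro s a hs j hj
  have h1 := congrFun hs (v j, w j)
  rw [Finset.sum_apply] at h1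
  rw [Finset.sum_eq_single j] at h1
  · exact (mul_eq_zero.mp h1).resolve_right (averagedMap_apply_self_ne_zero (h j))
  · intro i _ hij
    change a i * averagedMap (v i) (w i) (Finsupp.single (v j) 1) (w j) = 0
    rw [averagedMap_apply, Finset.sum_eq_zero, mul_zero]
    intro g _
    rw [if_neg]
    rintro ⟨h2, h3⟩
    exact hij (hne i j g h2 h3)
  · exact fun h2 => (h2 hj).elim

end Commutant

/-! ### Involutions matching points with their images -/

section PathInvolution

variable {X : Type*}

open Classical in
/-- The involution that exchanges each `x ∈ O` with `π x`. -/
def pathInvolution (π : Equiv.Perm X) (O : Finset X) (h : ∀ x ∈ O, π x ∉ O) : Equiv.Perm X :=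
  Function.Involutive.toPerm
    (fun x => if x ∈ O then π x else if π⁻¹ x ∈ O then π⁻¹ x else x) (by
      intro x
      have h1 : π⁻¹ (π x) = x := π.symm_apply_apply x
      have h2 : π (π⁻¹ x) = x := π.apply_symm_apply x
      by_cases hx : x ∈ O
      · simp [hx, h x hx, h1]
      · by_cases hx' : π⁻¹ x ∈ O
        · simp only [hx, hx', if_true, if_false, h2]
        · simp only [hx, hx', if_false])

variable {π : Equiv.Perm X} {O : Finset X} (h : ∀ x ∈ O, π x ∉ O)

theorem pathInvolution_apply_mem {x : X} (hx : x ∈ O) : pathInvolution π O h x = π x := if_pos hx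

theorem pathInvolution_cases (x : X) : pathInvolution π O h x = x ∨
    (x ∈ O ∧ pathInvolution π O h x = π x) ∨ ∃ y ∈ O, x = π y ∧ pathInvolution π O h x = y := by
  by_cases hx : x ∈ O
  · exact Or.inr (Or.inl ⟨hx, pathInvolution_apply_mem h hx⟩)
  · by_cases hx' : π⁻¹ x ∈ O
    · refine Or.inr (Or.inr ⟨_, hx', (π.apply_symm_apply x).symm, ?_⟩)
      exact (if_neg hx).trans (if_pos hx')
    · exact Or.inl ((if_neg hx).trans (if_neg hx'))

theorem pathInvolution_pathInvolution (x : X) :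
    pathInvolution π O h (pathInvolution π O h x) = x :=
  Function.Involutive.toPerm_involutive _ x

theorem isTransversal_pathInvolution : IsTransversal (pathInvolution π O h) O where
  fixed x hx hxO := by
    rw [pathInvolution_apply_mem h hxO] at hx
    have := h x hxO
    rw [hx] at this
    exact this hxO
  moved x hx := by
    rcases pathInvolution_cases h x with h1 | ⟨h1, h2⟩ | ⟨y, h1, rfl, h2⟩
    · exact (hx h1).elim
    · rw [h2]
      exact ⟨fun _ => h x h1, fun _ => h1⟩
    · rw [h2]
      exact ⟨fun h3 => (h y h1 h3).elim, fun h3 => (h3 h1).elim⟩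

theorem apply_pathInvolution {β : Type*} {f : X → β} (hf : ∀ x, f (π x) = f x) (x : X) :
    f (pathInvolution π O h x) = f x := by
  rcases pathInvolution_cases h x with h1 | ⟨-, h2⟩ | ⟨y, -, rfl, h2⟩
  · rw [h1]
  · rw [h2, hf]
  · rw [h2, hf]

end PathInvolution

/-! ### Splitting the cycles of a permutation into two involutions -/

section Alternating

variable {X : Type*} [Finite X] (π : Equiv.Perm X)

/-- A chosen point of the cycle of `x`. -/
def cycleBase (x : X) : X := Quotient.out (Quotient.mk (Equiv.Perm.SameCycle.setoid π) x)

omit [Finite X] in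
theorem sameCycle_cycleBase (x : X) : π.SameCycle (cycleBase π x) x :=
  Quotient.mk_out (s := Equiv.Perm.SameCycle.setoid π) x

omit [Finite X] in
theorem cycleBase_eq {x y : X} (h : π.SameCycle x y) : cycleBase π x = cycleBase π y := by
  unfold cycleBase
  rw [show Quotient.mk (Equiv.Perm.SameCycle.setoid π) x = Quotient.mk _ y from Quotient.sound h]

theorem minimalPeriod_perm_pos (x : X) : 0 < Function.minimalPeriod π x :=
  Function.minimalPeriod_pos_of_mem_periodicPts (π.injective.mem_periodicPts x)

omit [Finite X] in
theorem zpow_apply_eq_self_iff (x : X) (k : ℤ) :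
    (π ^ k) x = x ↔ (Function.minimalPeriod π x : ℤ) ∣ k :=
  MulAction.zpow_smul_eq_iff_minimalPeriod_dvd (a := π) (b := x) (n := k)

theorem exists_index (x : X) :
    ∃ k : ℕ, k < Function.minimalPeriod π (cycleBase π x) ∧ (π ^ k) (cycleBase π x) = x := by
  obtain ⟨i, hi⟩ := sameCycle_cycleBase π x
  have hpos := minimalPeriod_perm_pos π (cycleBase π x)
  obtain ⟨k, hk⟩ := Int.eq_ofNat_of_zero_le
    (Int.emod_nonneg i (show (Function.minimalPeriod π (cycleBase π x) : ℤ) ≠ 0 by omega))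
  have hlt := Int.emod_lt_of_pos i
    (show (0 : ℤ) < Function.minimalPeriod π (cycleBase π x) by omega)
  refine ⟨k, by omega, ?_⟩
  refine Eq.trans ?_ hi
  rw [← zpow_natCast, zpow_apply_eq_iff, zpow_apply_eq_self_iff, ← hk]
  exact dvd_sub_comm.mp Int.dvd_self_sub_emod

/-- The position of `x` in its cycle. -/
def cycleIndex (x : X) : ℕ := (exists_index π x).choose

theorem cycleIndex_lt (x : X) : cycleIndex π x < Function.minimalPeriod π (cycleBase π x) :=
  (exists_index π x).choose_spec.1

theorem pow_cycleIndex_apply (x : X) : (π ^ cycleIndex π x) (cycleBase π x) = x :=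
  (exists_index π x).choose_spec.2

theorem cycleIndex_eq {x : X} {k : ℕ} (hk : k < Function.minimalPeriod π (cycleBase π x))
    (h : (π ^ k) (cycleBase π x) = x) : cycleIndex π x = k := by
  have h1 : (π ^ (cycleIndex π x : ℤ)) (cycleBase π x) = (π ^ (k : ℤ)) (cycleBase π x) := by
    rw [zpow_natCast, zpow_natCast, h, pow_cycleIndex_apply]
  rw [zpow_apply_eq_iff, zpow_apply_eq_self_iff] at h1
  have := cycleIndex_lt π x
  have h2 := Int.eq_zero_of_abs_lt_dvd h1 (by rw [abs_lt]; omega)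
  omega

theorem cycleIndex_apply (x : X) : cycleIndex π (π x) = cycleIndex π x + 1 ∨
    cycleIndex π (π x) = 0 ∧ cycleIndex π x + 1 = Function.minimalPeriod π (cycleBase π x) := by
  have hb : cycleBase π (π x) = cycleBase π x :=
    cycleBase_eq π (Equiv.Perm.SameCycle.symm ⟨1, by simp⟩)
  have h1 : (π ^ (cycleIndex π x + 1)) (cycleBase π (π x)) = π x := by
    rw [hb, pow_succ', Equiv.Perm.mul_apply, pow_cycleIndex_apply]
  have hlt := cycleIndex_lt π x
  by_cases h : cycleIndex π x + 1 < Function.minimalPeriod π (cycleBase π x)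
  · exact Or.inl (cycleIndex_eq π (by rwa [hb]) h1)
  · have h2 : cycleIndex π x + 1 = Function.minimalPeriod π (cycleBase π x) := by omega
    refine Or.inr ⟨cycleIndex_eq π (by rw [hb]; omega) ?_, h2⟩
    refine Eq.trans ?_ h1
    rw [h2, hb, pow_zero, ← zpow_natCast]
    exact ((zpow_apply_eq_self_iff π _ _).mpr dvd_rfl).symm

/-- Every permutation `π` has a pair of involutions whose orbits are the cycles of `π`, with a common
transversal. -/
theorem exists_alternating_involutions : ∃ (τ₁ τ₂ : Equiv.Perm X) (O : Finset X),
    (∀ x, τ₁ (τ₁ x) = x) ∧ (∀ x, τ₂ (τ₂ x) = x) ∧ IsTransversal τ₁ O ∧ IsTransversal τ₂ O ∧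
    (∀ {β : Type} (f : X → β), (∀ x, f (π x) = f x) ↔
      (∀ x, f (τ₁ x) = f x) ∧ ∀ x, f (τ₂ x) = f x) := by
  classical
  have := Fintype.ofFinite X
  -- Points at odd positions are matched with their successors by one involution and with their
  -- predecessors by the other. The wrap-around goes to position 0, which is even, so `O` never
  -- contains two consecutive points, whatever the cycle length.
  let O : Finset X := Finset.univ.filter fun x => Odd (cycleIndex π x)
  have hO : ∀ x, x ∈ O ↔ Odd (cycleIndex π x) := fun x => by simp [O]
  have h₁ : ∀ x ∈ O, π x ∉ O := by
    intro x hx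
    rw [hO] at hx ⊢
    rcases cycleIndex_apply π x with h | ⟨h, -⟩
    · rw [h, Nat.not_odd_iff_even]
      exact hx.add_one
    · rw [h]
      decide
  have h₂ : ∀ x ∈ O, π⁻¹ x ∉ O := by
    intro x hx hx'
    have := h₁ _ hx'
    rw [show π (π⁻¹ x) = x from π.apply_symm_apply x] at this
    exact this hx
  refine ⟨pathInvolution π O h₁, pathInvolution π⁻¹ O h₂, O, pathInvolution_pathInvolution h₁,
    pathInvolution_pathInvolution h₂, isTransversal_pathInvolution h₁,
    isTransversal_pathInvolution h₂, fun f => ⟨fun hf => ⟨apply_pathInvolution h₁ hf,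
      apply_pathInvolution h₂ fun x => ?_⟩, fun ⟨f₁, f₂⟩ => ?_⟩⟩
  · rw [← hf (π⁻¹ x)]
    exact congrArg f (π.apply_symm_apply x)
  -- Of two consecutive positions exactly one is odd, so one of the two involutions joins them; the
  -- wrap-around step is not needed to reach the base point.
  · have hstep : ∀ x, cycleIndex π (π x) = cycleIndex π x + 1 → f (π x) = f x := by
      intro x hx
      by_cases hxO : x ∈ O
      · rw [← f₁ x, pathInvolution_apply_mem h₁ hxO]
      · have hxO' : π x ∈ O := by
          rw [hO, Nat.not_odd_iff_even] at hxO
          rw [hO, hx]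
          exact hxO.add_one
        rw [← f₂ (π x), pathInvolution_apply_mem h₂ hxO']
        exact congrArg f (π.symm_apply_apply x)
    have hbase : ∀ k : ℕ, ∀ x, cycleIndex π x = k → f x = f (cycleBase π x) := by
      intro k
      induction k with
      | zero =>
        intro x hx
        have h := pow_cycleIndex_apply π x
        rw [hx, pow_zero] at h
        exact congrArg f h.symm
      | succ k ih =>
        intro x hx
        have hy : π (π⁻¹ x) = x := π.apply_symm_apply x
        have hb : cycleBase π (π⁻¹ x) = cycleBase π x :=
          cycleBase_eq π ⟨1, by rw [zpow_one, hy]⟩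
        have h := cycleIndex_apply π (π⁻¹ x)
        rw [hy] at h
        rcases h with h | ⟨h, -⟩
        · have h3 := hstep (π⁻¹ x) (by rw [hy, h])
          rw [hy] at h3
          rw [h3, ih _ (by omega), hb]
        · omega
    intro x
    rw [hbase _ x rfl, hbase _ (π x) rfl,
      cycleBase_eq π (Equiv.Perm.SameCycle.symm (⟨1, by simp⟩ : π.SameCycle x (π x)))]

end Alternating

/-! ### Conjugacy in terms of colored cycles -/

section Conjugacy

theorem minimalPeriod_eq_card_sameCycle {X : Type*} [Finite X] (π : Equiv.Perm X) (x : X) :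
    Function.minimalPeriod π x = Nat.card {y // π.SameCycle x y} := by
  have := Fintype.ofFinite (MulAction.orbit (Subgroup.zpowers π) x)
  have h : Function.minimalPeriod π x = Fintype.card (MulAction.orbit (Subgroup.zpowers π) x) :=
    MulAction.minimalPeriod_eq_card (a := π) (b := x)
  rw [h, ← Nat.card_eq_fintype_card]
  refine Nat.card_congr (Equiv.subtypeEquivRight fun y => ?_)
  constructor
  · rintro ⟨⟨-, k, rfl⟩, rfl⟩
    exact ⟨k, rfl⟩
  · rintro ⟨k, rfl⟩
    exact ⟨⟨_, k, rfl⟩, rfl⟩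

variable {r n : ℕ} [NeZero r]

/-- The product of the colors along the cycle of `x`. -/
def cycleColor (g : G r n) (x : Fin n) : ZMod r :=
  color (g ^ Function.minimalPeriod (perm g) x) x

theorem cycleColor_perm (g : G r n) (x : Fin n) : cycleColor g (perm g x) = cycleColor g x := by
  have h1 : Function.minimalPeriod (perm g) (perm g x) = Function.minimalPeriod (perm g) x :=
    Function.minimalPeriod_apply ((perm g).injective.mem_periodicPts x)
  have h2 := color_mul (g ^ Function.minimalPeriod (perm g) x) g x
  rw [← pow_succ, pow_succ', color_mul, perm_pow,
    show (perm g ^ Function.minimalPeriod (perm g) x) x = x by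
      rw [← zpow_natCast]
      exact (zpow_apply_eq_self_iff _ _ _).mpr dvd_rfl, add_comm] at h2
  unfold cycleColor
  rw [h1]
  exact (add_left_cancel h2).symm

theorem color_zpow_of_perm_eq {g : G r n} {x : Fin n} (h : perm g x = x) (k : ℤ) :
    color (g ^ k) x = k * color g x := by
  have hk : ∀ k : ℤ, color (g ^ (k + 1)) x = color g x + color (g ^ k) x := by
    intro k
    rw [zpow_add_one, color_mul, h]
  induction k using Int.induction_on with
  | zero => simp [color_one]
  | succ k ih => rw [hk, ih]; push_cast; ring
  | pred k ih =>
    have h1 := hk (-k - 1)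
    rw [sub_add_cancel, ih] at h1
    rw [← sub_eq_iff_eq_add'.mpr h1]
    push_cast
    ring

/-- The colors of powers of `g` and `g'` differ by a function of the end point, on cycles of the
same length and color. -/
theorem perm_and_color_zpow_eq {g g' : G r n} {b b' : Fin n}
    (hl : Function.minimalPeriod (perm g) b = Function.minimalPeriod (perm g') b')
    (hc : cycleColor g b = cycleColor g' b') {k j : ℤ}
    (h : perm (g ^ k) b = perm (g ^ j) b) : perm (g' ^ k) b' = perm (g' ^ j) b' ∧
      color (g' ^ k) b' - color (g ^ k) b = color (g' ^ j) b' - color (g ^ j) b := by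
  rw [perm_zpow, perm_zpow, zpow_apply_eq_iff, zpow_apply_eq_self_iff] at h
  obtain ⟨q, hq⟩ := h
  -- Exponents with the same end point differ by `q` full turns, and each full turn adds the cycle
  -- color.
  have key : ∀ (g : G r n) (b : Fin n) (l : ℕ), Function.minimalPeriod (perm g) b = l →
      k - j = l * q → perm (g ^ k) b = perm (g ^ j) b ∧
      color (g ^ k) b = q * color (g ^ l) b + color (g ^ j) b := by
    rintro g b l rfl hq
    have hfix : perm (g ^ Function.minimalPeriod (perm g) b) b = b := by
      rw [← zpow_natCast, perm_zpow]
      exact (zpow_apply_eq_self_iff _ _ _).mpr dvd_rfl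
    have hfix' : perm ((g ^ Function.minimalPeriod (perm g) b) ^ q) b = b := by
      rw [perm_zpow]
      exact Function.IsFixedPt.perm_zpow (e := perm (g ^ Function.minimalPeriod (perm g) b)) hfix q
    have hk : g ^ k = g ^ j * (g ^ Function.minimalPeriod (perm g) b) ^ q := by
      rw [← zpow_natCast, ← zpow_mul, ← hq, ← zpow_add, add_sub_cancel]
    rw [hk, perm_mul, Equiv.Perm.mul_apply, color_mul, hfix', color_zpow_of_perm_eq hfix]
    exact ⟨rfl, rfl⟩
  obtain ⟨-, h1⟩ := key g b _ rfl hq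
  obtain ⟨h2, h3⟩ := key g' b' _ hl.symm hq
  refine ⟨h2, ?_⟩
  unfold cycleColor at hc
  rw [← hl] at hc
  rw [h1, h3, hc]
  ring

/-- Colored permutations are conjugate if some bijection matches their cycles and the colors of the
cycles. -/
theorem isConj_of_cycleColor_eq {g g' : G r n} (σ : Equiv.Perm (Fin n))
    (hcyc : ∀ x y, (perm g).SameCycle x y ↔ (perm g').SameCycle (σ x) (σ y))
    (hcol : ∀ x, cycleColor g' (σ x) = cycleColor g x) : IsConj g g' := by
  have hl : ∀ x, Function.minimalPeriod (perm g) x = Function.minimalPeriod (perm g') (σ x) := by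
    intro x
    rw [minimalPeriod_eq_card_sameCycle, minimalPeriod_eq_card_sameCycle]
    exact Nat.card_congr (σ.subtypeEquiv fun y => hcyc x y)
  let b : Fin n → Fin n := cycleBase (perm g)
  choose k hk using fun x => sameCycle_cycleBase (perm g) x
  have hk' : ∀ x, perm (g ^ k x) (b x) = x := fun x => by
    rw [perm_zpow]
    exact hk x
  -- Only the values of `σ` at base points are kept: `η` carries the `g`-walk from a base point to
  -- the `g'`-walk from its image, and `z` corrects the colors. Equal lengths and cycle colors make
  -- both independent of the exponent.
  let η : Fin n → Fin n := fun x => perm (g' ^ k x) (σ (b x))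
  let z : Fin n → ZMod r := fun x => color (g' ^ k x) (σ (b x)) - color (g ^ k x) (b x)
  have hη : ∀ x (j : ℤ), perm (g ^ j) (b x) = x → η x = perm (g' ^ j) (σ (b x)) ∧
      z x = color (g' ^ j) (σ (b x)) - color (g ^ j) (b x) := fun x j hj =>
    perm_and_color_zpow_eq (hl _) (hcol _).symm ((hk' x).trans hj.symm)
  have hinj : Function.Injective η := by
    intro x y hxy
    have hb : b x = b y := by
      have h1 : (perm g').SameCycle (σ (b x)) (η x) := ⟨k x, by rw [← perm_zpow]⟩
      have h2 : (perm g').SameCycle (σ (b y)) (η y) := ⟨k y, by rw [← perm_zpow]⟩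
      rw [← hxy] at h2
      have h3 := (hcyc _ _).mpr (h1.trans h2.symm)
      exact cycleBase_eq _ (((sameCycle_cycleBase _ x).symm.trans h3).trans
        (sameCycle_cycleBase _ y))
    have h1 : perm (g' ^ k x) (σ (b x)) = perm (g' ^ k y) (σ (b x)) := by
      rw [show perm (g' ^ k x) (σ (b x)) = η x from rfl, hxy, hb]
    have h2 := (perm_and_color_zpow_eq (hl (b x)).symm (hcol _) h1).1
    rw [hk', hb, hk'] at h2
    exact h2
  have hbij := Finite.injective_iff_bijective.mp hinj
  rw [isConj_iff]
  refine ⟨colored (Equiv.ofBijective η hbij) z, ?_⟩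
  rw [mul_inv_eq_iff_eq_mul]
  have hstep : ∀ x, b (perm g x) = b x ∧ perm (g ^ (k x + 1)) (b x) = perm g x := fun x => by
    refine ⟨cycleBase_eq _ (Equiv.Perm.SameCycle.symm ⟨1, by rw [zpow_one]⟩), ?_⟩
    rw [add_comm, zpow_one_add, perm_mul, Equiv.Perm.mul_apply, hk']
  have hz : ∀ (g : G r n) (j : ℤ) x, color (g ^ (j + 1)) x =
      color (g ^ j) x + color g (perm (g ^ j) x) := fun g j x => by
    rw [add_comm, zpow_one_add, color_mul]
  refine ext_of_perm_of_color (fun x => ?_) fun x => ?_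
  · obtain ⟨hb, hs⟩ := hstep x
    have h := (hη (perm g x) (k x + 1) (by rw [hb, hs])).1
    rw [perm_mul, perm_mul, Equiv.Perm.mul_apply, Equiv.Perm.mul_apply, perm_colored]
    change η (perm g x) = perm g' (η x)
    rw [h, hb, add_comm, zpow_one_add, perm_mul, Equiv.Perm.mul_apply]
  · obtain ⟨hb, hs⟩ := hstep x
    have h := (hη (perm g x) (k x + 1) (by rw [hb, hs])).2
    rw [color_mul, color_mul, color_colored, color_colored, perm_colored, h, hb, hz, hz, hk']
    change _ = color (g' ^ k x) (σ (b x)) - color (g ^ k x) (b x) +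
      color g' (perm (g' ^ k x) (σ (b x)))
    ring

end Conjugacy

/-! ### An admissible pair for each conjugacy class -/

section Counting

variable {r n : ℕ} [NeZero r]

/-- On elements commuting with both involutions, each sign is the same expression in the common
transversal, and the pairings agree because the colors do. -/
theorem isAdmissible_of_isTransversal {v w : absInvolutions r n} (hc : color v.1 = color w.1)
    {O : Finset (Fin n)} (hv : IsTransversal (perm v.1) O) (hw : IsTransversal (perm w.1) O) :
    IsAdmissible v w := by
  intro g h1 h2
  have hcomm : ∀ v : absInvolutions r n, absConj g v = v →
      perm g * perm v.1 = perm v.1 * perm g := fun v h =>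
    Equiv.ext ((absConj_eq_iff g v v).mp h).1
  rw [coefficient_eq, coefficient_eq, invSign_eq_prod_of_commute (perm_perm v) (hcomm v h1) hv,
    invSign_eq_prod_of_commute (perm_perm w) (hcomm w h2) hw]
  unfold pairing
  rw [hc]

/-- Every conjugacy class yields an admissible pair of absolute involutions, from which it can be
recovered. -/
theorem exists_admissible_pairs (r n : ℕ) [NeZero r] :
    ∃ v w : ConjClasses (G r n) → absInvolutions r n, (∀ C, IsAdmissible (v C) (w C)) ∧
      ∀ C C' (h : G r n), absConj h (v C) = v C' → absConj h (w C) = w C' → C = C' := by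
  choose τ₁ τ₂ O h₁ h₂ t₁ t₂ hf using fun g : G r n => exists_alternating_involutions (perm g)
  have hcol : ∀ g : G r n, (∀ x, cycleColor g (τ₁ g x) = cycleColor g x) ∧
      ∀ x, cycleColor g (τ₂ g x) = cycleColor g x := fun g =>
    (hf g _).mp (cycleColor_perm g)
  let v : G r n → absInvolutions r n := fun g =>
    coloredInvolution (τ₁ g) (cycleColor g) (h₁ g) (hcol g).1
  let w : G r n → absInvolutions r n := fun g =>
    coloredInvolution (τ₂ g) (cycleColor g) (h₂ g) (hcol g).2
  have hv : ∀ g, perm (v g).1 = τ₁ g ∧ color (v g).1 = cycleColor g := fun g =>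
    ⟨perm_colored _ _, funext (color_colored _ _)⟩
  have hw : ∀ g, perm (w g).1 = τ₂ g ∧ color (w g).1 = cycleColor g := fun g =>
    ⟨perm_colored _ _, funext (color_colored _ _)⟩
  have hcyc : ∀ (g g' : G r n) (σ : Equiv.Perm (Fin n)), (∀ x, σ (τ₁ g x) = τ₁ g' (σ x)) →
      (∀ x, σ (τ₂ g x) = τ₂ g' (σ x)) → ∀ x y, (perm g).SameCycle x y →
      (perm g').SameCycle (σ x) (σ y) := by
    intro g g' σ s₁ s₂ x y hxy
    -- Functions invariant under both involutions are exactly those constant on the cycles; applied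
    -- to the cycle map of `perm g'`, this shows that `σ` carries cycles into cycles.
    let f : Fin n → Quotient (Equiv.Perm.SameCycle.setoid (perm g')) := Quotient.mk _
    have hf' := (hf g' f).mp fun x =>
      Quotient.sound (Equiv.Perm.SameCycle.symm ⟨1, by rw [zpow_one]⟩)
    have hfσ : ∀ x, f (σ (perm g x)) = f (σ x) := (hf g fun x => f (σ x)).mpr
      ⟨fun x => by rw [s₁, hf'.1], fun x => by rw [s₂, hf'.2]⟩
    have hz : ∀ (k : ℤ) x, f (σ ((perm g ^ k) x)) = f (σ x) := by
      intro k
      induction k using Int.induction_on with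
      | zero => intro x; rfl
      | succ k ih => intro x; rw [zpow_add_one, Equiv.Perm.mul_apply, ih, hfσ]
      | pred k ih =>
        intro x
        rw [zpow_sub_one, Equiv.Perm.mul_apply, ih, ← hfσ ((perm g)⁻¹ x)]
        exact congrArg (fun x => f (σ x)) ((perm g).apply_symm_apply x)
    obtain ⟨k, rfl⟩ := hxy
    exact Quotient.exact (hz k x).symm
  refine ⟨fun C => v C.out, fun C => w C.out, fun C => ?_, fun C C' h hC hC' => ?_⟩
  · refine isAdmissible_of_isTransversal (O := O C.out) ?_ ?_ ?_
    · rw [(hv _).2, (hw _).2]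
    · rw [(hv _).1]
      exact t₁ _
    · rw [(hw _).1]
      exact t₂ _
  · rw [absConj_eq_iff, (hv _).1, (hv _).1, (hv _).2, (hv _).2] at hC
    rw [absConj_eq_iff, (hw _).1, (hw _).1] at hC'
    -- The inverse of `h` intertwines in the other direction, which gives the converse inclusion of
    -- cycles.
    have hback : ∀ {τ τ' : Equiv.Perm (Fin n)}, (∀ x, perm h (τ x) = τ' (perm h x)) →
        ∀ x, (perm h)⁻¹ (τ' x) = τ ((perm h)⁻¹ x) := by
      intro τ τ' hττ x
      have hx : perm h ((perm h)⁻¹ x) = x := (perm h).apply_symm_apply x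
      rw [Equiv.Perm.inv_eq_iff_eq, hττ, hx]
    have hconj : IsConj C.out C'.out := by
      refine isConj_of_cycleColor_eq (perm h) (fun x y => ⟨hcyc _ _ _ hC.1 hC'.1 x y, fun hxy => ?_⟩)
        fun x => (hC.2 x).symm
      have h3 := hcyc _ _ _ (hback hC.1) (hback hC'.1) _ _ hxy
      have hx : ∀ x, (perm h)⁻¹ (perm h x) = x := (perm h).symm_apply_apply
      rwa [hx, hx] at h3
    rw [← Quotient.out_eq C, ← Quotient.out_eq C']
    exact Quotient.sound hconj

theorem isModel_modelRep (r n : ℕ) [NeZero r] : IsModel (modelRep r n) := by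
  have := Fintype.ofFinite (G r n)
  obtain ⟨v, w, hadm, hne⟩ := exists_admissible_pairs r n
  exact isModel_of_commute intertwining_commute _ (linearIndependent_averagedMap v w hadm hne)

end Counting

end WreathModel

end

theorem mainTheorem2 (r n : ℕ) [NeZero r] :
    (∀ v : WreathModel.G r n,
      v ∈ WreathModel.absInvolutions r n ↔ (WreathModel.mat v).IsSymm) ∧
    ∃ ρ : Representation ℂ (WreathModel.G r n) (WreathModel.absInvolutions r n →₀ ℂ),
      (∀ (g : WreathModel.G r n) (v : WreathModel.absInvolutions r n),
        ρ g (Finsupp.single v 1) =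
          (WreathModel.zeta r ^ (WreathModel.pairing g v).val *
              (-1) ^ WreathModel.invPerm (WreathModel.perm v.1) (WreathModel.perm g)) •
            Finsupp.single (WreathModel.absConj g v) 1) ∧
      WreathModel.IsModel ρ := by
  exact ⟨WreathModel.mem_absInvolutions_iff_isSymm, WreathModel.modelRep r n,
    fun g v => by
      rw [WreathModel.modelRep_single, one_mul, Finsupp.smul_single, smul_eq_mul, mul_one]
      rfl,
    WreathModel.isModel_modelRep r n⟩
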